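/- All graphs are finite, simple and undirected. A graph is \emph{outerplanar} if it can be drawn in the plane, with distinct points as vertices and with simple arcs as edges that meet one another only at common end vertices and that contain no vertices other than their own ends, so that every vertex lies on the boundary of the unbounded face. A graph is \emph{Hamiltonian} if it contains a Hamiltonian cycle (so it has at least three vertices). For a convex polygon $P$ with $n\ge 3$ sides $s_0,\dots,s_{n-1}$, let $D_i$ denote the closed disk that has $s_i$ as a diameter (centered at the midpoint of $s_i$), and let $G(P)$ be the intersection graph of $D_0,\dots,D_{n-1}$: its vertices are these $n$ disks, and two distinct disks are adjacent if and only if they have a point in common. A graph $G$ is \emph{side-disk realizable} if $G$ is isomorphic to $G(P)$ for some convex polygon $P$. \textbf{Theorem.} Every outerplanar Hamiltonian graph that is not isomorphic to the cycle $C_4$ of length four is side-disk realizable. -/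

import Mathlib

/-- The Euclidean plane. -/
abbrev Plane : Type := EuclideanSpace ℝ (Fin 2)

/-! ## Outerplanar graphs -/

/-- A plane drawing (planar embedding) of a graph: vertices are distinct points, every edge is a
simple arc joining its two end points, an arc contains no vertex besides its two ends, and two
distinct arcs meet only at common ends of the two edges. -/
structure PlaneDrawing {V : Type*} (G : SimpleGraph V) where
  /-- The point that represents a vertex. -/
  pos : V → Plane
  /-- The arc, as a point set, that represents an edge. -/
  arc : G.edgeSet → Set Plane
  pos_injective : Function.Injective pos
  isArc : ∀ (u v : V) (h : G.Adj u v), ∃ γ : Path (pos u) (pos v),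
    Function.Injective γ ∧ Set.range γ = arc ⟨s(u, v), h⟩
  mem_of_pos_mem_arc : ∀ (e : G.edgeSet) (w : V), pos w ∈ arc e → w ∈ (e : Sym2 V)
  arc_inter_arc : ∀ e f : G.edgeSet, e ≠ f → ∀ x ∈ arc e ∩ arc f,
    ∃ v : V, v ∈ (e : Sym2 V) ∧ v ∈ (f : Sym2 V) ∧ x = pos v

namespace PlaneDrawing

variable {V : Type*} {G : SimpleGraph V}

/-- The subset of the plane covered by the drawing. -/
def support (D : PlaneDrawing G) : Set Plane :=
  Set.range D.pos ∪ ⋃ e : G.edgeSet, D.arc e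

/-- The faces of a drawing are the connected components of its complement. -/
def IsFace (D : PlaneDrawing G) (F : Set Plane) : Prop :=
  ∃ x ∈ D.supportᶜ, F = connectedComponentIn D.supportᶜ x

/-- The outer face is the unbounded face. -/
def IsOuterFace (D : PlaneDrawing G) (F : Set Plane) : Prop :=
  D.IsFace F ∧ ¬ Bornology.IsBounded F

end PlaneDrawing

/-- A graph is outerplanar if it has a plane drawing in which every vertex lies on the boundary
of the outer face. -/
def IsOuterplanar {V : Type*} (G : SimpleGraph V) : Prop :=
  ∃ (D : PlaneDrawing G) (F : Set Plane), D.IsOuterFace F ∧ ∀ v : V, D.pos v ∈ frontier F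

/-! ## Convex polygons and their side disks -/

/-- Twice the signed area of the triangle `a b c`; it is positive if and only if `c` lies strictly
to the left of the line through `a` and `b`, directed from `a` to `b`. -/
def signedArea (a b c : Plane) : ℝ :=
  (b 0 - a 0) * (c 1 - a 1) - (b 1 - a 1) * (c 0 - a 0)

namespace Polygon

variable {n : ℕ}

/-- The polygon has at least three vertices and is (strictly) convex, with its vertices listed
in counter-clockwise order along the boundary: for every side, all vertices other than its two ends
lie strictly to the left of the directed line through that side. Side `i` joins vertex `i` to its
cyclic successor `finRotate n i`. -/
def IsConvexCCW (P : Polygon Plane n) : Prop :=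
  3 ≤ n ∧ ∀ i k : Fin n, k ≠ i → k ≠ finRotate n i →
    0 < signedArea (P i) (P (finRotate n i)) (P k)

/-- The closed disk centred at the midpoint of side `i` that has this side as a diameter. -/
noncomputable def sideDisk (P : Polygon Plane n) (i : Fin n) : Set Plane :=
  Metric.closedBall (midpoint ℝ (P i) (P (finRotate n i))) (dist (P i) (P (finRotate n i)) / 2)

/-- The intersection graph of the side disks. The disk of side `i` is represented by the
index `i` (the `n` side disks of a convex polygon are pairwise distinct). -/
def sideDiskGraph (P : Polygon Plane n) : SimpleGraph (Fin n) where
  Adj i j := i ≠ j ∧ (P.sideDisk i ∩ P.sideDisk j).Nonempty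
  symm := ⟨fun _ _ h => ⟨h.1.symm, by rw [Set.inter_comm]; exact h.2⟩⟩
  loopless := ⟨fun _ h => h.1 rfl⟩

end Polygon

/-- A graph is side-disk realizable if it is isomorphic to the intersection graph of the side disks
of some convex polygon. -/
def SideDiskRealizable {V : Type*} (G : SimpleGraph V) : Prop :=
  ∃ (n : ℕ) (P : Polygon Plane n), P.IsConvexCCW ∧ Nonempty (G ≃g P.sideDiskGraph)

/-! ### Variation of the logarithm along a path -/

/-! Chords of a Hamiltonian cycle in an outerplanar graph do not cross
(`IsOuterplanar.not_crossing`). Two crossing chords and the four arcs of the cycle between their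
ends would draw a subdivided complete graph on four vertices. Each branch vertex lies on the outer
boundary, so it can be joined to infinity off the triangle on the other three, and all four winding
numbers vanish. But a signed sum of these numbers is odd (`k4_winding`).

Conversely, a Hamiltonian cycle with non-crossing chords, other than the 4-cycle, is realized by a
polygon inscribed in the unit circle, with sides in cyclic order. Contact of two side disks then
depends only on the two half central angles and the arc between the sides. They meet when this arc
is tiny compared with both sides (`disksMeet_of_gap`). Suitably short sides do not meet when both
arcs between them are at least as long as one of the sides (`not_disksMeet_of_short`).

Without chords a regular polygon works. Otherwise one chord is chosen as root and its ends become
two equal long sides. Every other side gets a length that depends on the number of chords above it,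
each level being tiny compared with the one before. All sides under a chord have higher level than
its ends, so the arc there is negligible. Between non-adjacent sides on one side of the root,
non-crossing forces a side of level at most the larger of their two levels
(`exists_chordLevel_le_max`), which separates their disks. -/

theorem exists_continuous_log {X : Type*} [TopologicalSpace X] [LocallyPathConnectedSpace X]
    [ContractibleSpace X] {f : X → ℂ} (hf : Continuous f) (h0 : ∀ x, f x ≠ 0) :
    ∃ L : X → ℂ, Continuous L ∧ ∀ x, Complex.exp (L x) = f x := by
  have : ContractibleSpace (Set.univ : Set X) :=
    (Homeomorph.Set.univ X).toHomotopyEquiv.contractibleSpace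
  have hs : IsSimplyConnected (Set.univ : Set X) := SimplyConnectedSpace.ofContractible _
  obtain ⟨L, hL, hL'⟩ := Complex.exists_continuousOn_eqOn_exp_comp hs isOpen_univ
    hf.continuousOn (by simpa using h0)
  exact ⟨L, continuousOn_univ.1 hL, fun x => hL' (Set.mem_univ x)⟩

open Classical in
/-- The change of a continuous logarithm of `f` between the times `0` and `1`. -/
noncomputable def logVar (f : ℝ → ℂ) : ℂ :=
  if h : ∃ L : ℝ → ℂ, Continuous L ∧ ∀ x, Complex.exp (L x) = f x then
    h.choose 1 - h.choose 0 else 0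

/-- Two continuous logarithms are lifts through the covering map `exp`, so they agree once their
values at 0 are matched. The chosen logarithm is therefore irrelevant. -/
theorem logVar_eq {f L : ℝ → ℂ} (hL : Continuous L) (hf : ∀ x, Complex.exp (L x) = f x) :
    logVar f = L 1 - L 0 := by
  have h : ∃ L : ℝ → ℂ, Continuous L ∧ ∀ x, Complex.exp (L x) = f x := ⟨L, hL, hf⟩
  rw [logVar, dif_pos h]
  obtain ⟨hM, hMf⟩ := h.choose_spec
  set M := h.choose
  have key : (fun x => M x - M 0 + L 0) = L := by
    refine Complex.isCoveringMap_exp.eq_of_comp_eq (by fun_prop) hL ?_ 0 (by simp)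
    funext x
    refine Subtype.ext ?_
    simp [Complex.exp_add, Complex.exp_sub, hf, hMf]
    have : f 0 ≠ 0 := by rw [← hf 0]; exact Complex.exp_ne_zero _
    field_simp
  have := congrFun key 1
  rw [← this]; ring

theorem exp_logVar {f : ℝ → ℂ} (hf : Continuous f) (h0 : ∀ x, f x ≠ 0) :
    Complex.exp (logVar f) = f 1 / f 0 := by
  obtain ⟨L, hL, h⟩ := exists_continuous_log hf h0
  rw [logVar_eq hL h, Complex.exp_sub, h, h]

theorem logVar_neg {f : ℝ → ℂ} (hf : Continuous f) (h0 : ∀ x, f x ≠ 0) :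
    logVar (fun x => -f x) = logVar f := by
  obtain ⟨L, hL, h⟩ := exists_continuous_log hf h0
  rw [logVar_eq hL h, logVar_eq (L := fun x => L x + Real.pi * Complex.I) (by fun_prop)]
  · ring
  · intro x; simp [Complex.exp_add, h]

theorem logVar_sub_comm {f g : ℝ → ℂ} (hf : Continuous f) (hg : Continuous g)
    (h : ∀ x, f x ≠ g x) : logVar (fun x => f x - g x) = logVar (fun x => g x - f x) := by
  rw [← logVar_neg (f := fun x => g x - f x) (hg.sub hf) fun x => sub_ne_zero.2 (h x).symm]
  simp

theorem logVar_const (z : ℂ) : logVar (fun _ => z) = 0 := by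
  by_cases hz : z = 0
  -- The zero function has no logarithm, so the default value 0 applies.
  · rw [logVar, dif_neg]
    rintro ⟨L, -, h⟩
    exact Complex.exp_ne_zero _ ((h 0).trans hz)
  · rw [logVar_eq (L := fun _ => Complex.log z) continuous_const fun _ => Complex.exp_log hz]
    simp

/-- A nowhere zero function on the whole plane has a global logarithm, so its variation around the
boundary of the unit square is zero. -/
theorem logVar_square {F : ℝ → ℝ → ℂ} (hF : Continuous (Function.uncurry F))
    (h0 : ∀ x y, F x y ≠ 0) :
    logVar (F 0) + logVar (fun x => F x 1) = logVar (fun x => F x 0) + logVar (F 1) := by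
  obtain ⟨L, hL, h⟩ := exists_continuous_log hF (fun p => h0 p.1 p.2)
  rw [logVar_eq (f := F 0) (L := fun y => L (0, y)) (by fun_prop) fun y => h (0, y),
    logVar_eq (f := F 1) (L := fun y => L (1, y)) (by fun_prop) fun y => h (1, y),
    logVar_eq (f := fun x => F x 0) (L := fun x => L (x, 0)) (by fun_prop) fun x => h (x, 0),
    logVar_eq (f := fun x => F x 1) (L := fun x => L (x, 1)) (by fun_prop) fun x => h (x, 1)]
  ring

/-- The winding numbers of three paths that form a triangle are invariant when the centre moves
along a path that avoids the triangle. -/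
theorem triangle_logVar_move {f g h x : ℝ → ℂ} (hf : Continuous f) (hg : Continuous g)
    (hh : Continuous h) (hx : Continuous x) (hfx : ∀ t s, f t ≠ x s) (hgx : ∀ t s, g t ≠ x s)
    (hhx : ∀ t s, h t ≠ x s) (h1 : f 1 = g 0) (h2 : f 0 = h 0) (h3 : g 1 = h 1) :
    logVar (fun t => f t - x 0) + logVar (fun t => g t - x 0) - logVar (fun t => h t - x 0) =
    logVar (fun t => f t - x 1) + logVar (fun t => g t - x 1) - logVar (fun t => h t - x 1) := by
  have e1 := logVar_square (F := fun s t => f t - x s) (by fun_prop)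
    (fun s t => sub_ne_zero.2 (hfx t s))
  have e2 := logVar_square (F := fun s t => g t - x s) (by fun_prop)
    (fun s t => sub_ne_zero.2 (hgx t s))
  have e3 := logVar_square (F := fun s t => h t - x s) (by fun_prop)
    (fun s t => sub_ne_zero.2 (hhx t s))
  simp only [h1, h2, h3] at e1 e2 e3
  linear_combination e1 + e2 - e3

/-- Shrinking the triangle to the origin never meets a point farther out than the triangle, and a
constant path has no variation. The scaling factor is clamped to the unit interval because homotopy
parameters range over all reals. -/
theorem triangle_logVar_far {f g h : ℝ → ℂ} {x : ℂ} (hf : Continuous f) (hg : Continuous g)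
    (hh : Continuous h) (hfx : ∀ t, ‖f t‖ < ‖x‖) (hgx : ∀ t, ‖g t‖ < ‖x‖)
    (hhx : ∀ t, ‖h t‖ < ‖x‖) (h1 : f 1 = g 0) (h2 : f 0 = h 0) (h3 : g 1 = h 1) :
    logVar (fun t => f t - x) + logVar (fun t => g t - x) - logVar (fun t => h t - x) = 0 := by
  have key : ∀ f : ℝ → ℂ, (∀ t, ‖f t‖ < ‖x‖) → ∀ s t : ℝ,
      ((Set.projIcc (0 : ℝ) 1 zero_le_one s : ℝ) : ℂ) * f t - x ≠ 0 := by
    intro f hf s t h0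
    have h1 := (Set.projIcc (0 : ℝ) 1 zero_le_one s).2
    have h2 : ‖((Set.projIcc (0 : ℝ) 1 zero_le_one s : ℝ) : ℂ) * f t‖ = ‖x‖ := by
      rw [sub_eq_zero.1 h0]
    rw [norm_mul, Complex.norm_real, Real.norm_of_nonneg h1.1] at h2
    have := mul_le_mul_of_nonneg_right h1.2 (norm_nonneg (f t))
    linarith [hf t]
  have cont : Continuous fun s : ℝ => ((Set.projIcc (0 : ℝ) 1 zero_le_one s : ℝ) : ℂ) :=
    Complex.continuous_ofReal.comp (continuous_subtype_val.comp continuous_projIcc)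
  have aux : ∀ f : ℝ → ℂ, Continuous f → Continuous (Function.uncurry fun s t : ℝ =>
      ((Set.projIcc (0 : ℝ) 1 zero_le_one s : ℝ) : ℂ) * f t - x) := fun f hf =>
    ((cont.comp continuous_fst).mul (hf.comp continuous_snd)).sub continuous_const
  have e1 := logVar_square (aux f hf) (key f hfx)
  have e2 := logVar_square (aux g hg) (key g hgx)
  have e3 := logVar_square (aux h hh) (key h hhx)
  simp only [h1, h2, h3, Set.projIcc_left, Set.projIcc_right, Complex.ofReal_zero,
    Complex.ofReal_one, zero_mul, one_mul, logVar_const] at e1 e2 e3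
  linear_combination e3 - e1 - e2

theorem square_logVar {f g : ℝ → ℂ} (hf : Continuous f) (hg : Continuous g)
    (h : ∀ s t, f s ≠ g t) :
    logVar (fun s => f s - g 1) + logVar (fun t => g t - f 0) =
      logVar (fun s => f s - g 0) + logVar (fun t => g t - f 1) := by
  have := logVar_square (F := fun s t => f s - g t) (by fun_prop)
    (fun s t => sub_ne_zero.2 (h s t))
  rw [logVar_sub_comm continuous_const hg (fun t => h 0 t),
    logVar_sub_comm continuous_const hg (fun t => h 1 t)] at this
  linear_combination this

/-- In a planar drawing of the complete graph on four vertices, some vertex has nonzero winding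
number with respect to the triangle on the other three. -/
theorem k4_winding {a b c d : ℂ} {ab ac ad bc bd cd : ℝ → ℂ}
    (cab : Continuous ab) (cac : Continuous ac) (cad : Continuous ad)
    (cbc : Continuous bc) (cbd : Continuous bd) (ccd : Continuous cd)
    (ab0 : ab 0 = a) (ab1 : ab 1 = b) (ac0 : ac 0 = a) (ac1 : ac 1 = c) (ad0 : ad 0 = a)
    (ad1 : ad 1 = d) (bc0 : bc 0 = b) (bc1 : bc 1 = c) (bd0 : bd 0 = b) (bd1 : bd 1 = d)
    (cd0 : cd 0 = c) (cd1 : cd 1 = d)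
    (h1 : ∀ s t, ab s ≠ cd t) (h2 : ∀ s t, ac s ≠ bd t) (h3 : ∀ s t, ad s ≠ bc t)
    (td : logVar (fun t => ab t - d) + logVar (fun t => bc t - d) - logVar (fun t => ac t - d) = 0)
    (tc : logVar (fun t => ab t - c) + logVar (fun t => bd t - c) - logVar (fun t => ad t - c) = 0)
    (tb : logVar (fun t => ac t - b) + logVar (fun t => cd t - b) - logVar (fun t => ad t - b) = 0)
    (ta : logVar (fun t => bc t - a) + logVar (fun t => cd t - a) - logVar (fun t => bd t - a) = 0) :
    False := by
  have q1 := square_logVar cab ccd h1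
  have q2 := square_logVar cac cbd h2
  have q3 := square_logVar cad cbc h3
  rw [ab0, ab1, cd0, cd1] at q1
  rw [ac0, ac1, bd0, bd1] at q2
  rw [ad0, ad1, bc0, bc1] at q3
  -- Each hypothesis on a triangle is a winding number times 2πi. Modulo the three square identities
  -- their signed sum is twice the left side here, which explains the factor 1/2.
  have S : logVar (fun t => ac t - b) - logVar (fun t => ab t - c) - logVar (fun t => bc t - a)
      = 0 := by
    linear_combination (1 / 2 : ℂ) * (tb - tc - td - ta + q1 - q2 - q3)
  have e1 := exp_logVar (f := fun t => ac t - b) (by fun_prop)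
    (fun t => sub_ne_zero.2 (bd0 ▸ h2 t 0))
  have e2 := exp_logVar (f := fun t => ab t - c) (by fun_prop)
    (fun t => sub_ne_zero.2 (cd0 ▸ h1 t 0))
  have e3 := exp_logVar (f := fun t => bc t - a) (by fun_prop)
    (fun t => sub_ne_zero.2 (ad0 ▸ (h3 0 t).symm))
  have n1 : a - b ≠ 0 := sub_ne_zero.2 (ad0 ▸ bc0 ▸ h3 0 0)
  have n2 : a - c ≠ 0 := sub_ne_zero.2 (ab0 ▸ cd0 ▸ h1 0 0)
  have n3 : b - c ≠ 0 := sub_ne_zero.2 (ab1 ▸ cd0 ▸ h1 1 0)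
  -- The exponential of the left side is a quotient of products of differences that equals -1, so
  -- the variation is an odd multiple of πi and cannot vanish.
  have E := congrArg Complex.exp S
  rw [Complex.exp_sub, Complex.exp_sub, e1, e2, e3, ab0, ab1, ac0, ac1, bc0, bc1,
    Complex.exp_zero] at E
  have n1' : b - a ≠ 0 := sub_ne_zero.2 (sub_ne_zero.1 n1).symm
  have n2' : c - a ≠ 0 := sub_ne_zero.2 (sub_ne_zero.1 n2).symm
  have n3' : c - b ≠ 0 := sub_ne_zero.2 (sub_ne_zero.1 n3).symm
  field_simp at E
  have : (a - b) * (a - c) * (b - c) = 0 := by linear_combination (1 / 2 : ℂ) * E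
  simp_all

/-! ### Chords of a Hamiltonian cycle of an outerplanar graph do not cross -/

namespace PlaneDrawing

variable {V : Type*} {G : SimpleGraph V}

/-- The part of a drawing that represents the subgraph induced by `S`. -/
def region (D : PlaneDrawing G) (S : Set V) : Set Plane :=
  {x | (∃ v ∈ S, x = D.pos v) ∨
    ∃ (u v : V) (h : G.Adj u v), u ∈ S ∧ v ∈ S ∧ x ∈ D.arc ⟨s(u, v), h⟩}

theorem region_mono (D : PlaneDrawing G) {S T : Set V} (h : S ⊆ T) : D.region S ⊆ D.region T := by
  rintro x (⟨v, hv, rfl⟩ | ⟨u, v, e, hu, hv, hx⟩)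
  · exact Or.inl ⟨v, h hv, rfl⟩
  · exact Or.inr ⟨u, v, e, h hu, h hv, hx⟩

theorem region_subset_support (D : PlaneDrawing G) (S : Set V) : D.region S ⊆ D.support := by
  rintro x (⟨v, hv, rfl⟩ | ⟨u, v, e, hu, hv, hx⟩)
  · exact Or.inl ⟨v, rfl⟩
  · exact Or.inr (Set.mem_iUnion.2 ⟨_, hx⟩)

/-- Used in contrapositive form: disjoint vertex sets have disjoint regions, because arcs meet only
at common ends. -/
theorem exists_mem_of_mem_region (D : PlaneDrawing G) {S T : Set V} {x : Plane}
    (hS : x ∈ D.region S) (hT : x ∈ D.region T) : ∃ v, v ∈ S ∧ v ∈ T := by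
  rcases hS with ⟨v, hv, rfl⟩ | ⟨u, v, e, hu, hv, hx⟩ <;>
    rcases hT with ⟨v', hv', hx'⟩ | ⟨u', v', e', hu', hv', hx'⟩
  · exact ⟨v, hv, D.pos_injective hx' ▸ hv'⟩
  · have := D.mem_of_pos_mem_arc _ _ hx'
    rcases Sym2.mem_iff.1 this with rfl | rfl
    exacts [⟨_, hv, hu'⟩, ⟨_, hv, hv'⟩]
  · subst hx'
    have := D.mem_of_pos_mem_arc _ _ hx
    rcases Sym2.mem_iff.1 this with rfl | rfl
    exacts [⟨_, hu, hv'⟩, ⟨_, hv, hv'⟩]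
  · by_cases h : (⟨s(u, v), e⟩ : G.edgeSet) = ⟨s(u', v'), e'⟩
    · have h' : s(u, v) = s(u', v') := congrArg Subtype.val h
      rcases Sym2.eq_iff.1 h' with ⟨rfl, rfl⟩ | ⟨rfl, rfl⟩
      exacts [⟨_, hu, hu'⟩, ⟨_, hu, hv'⟩]
    · obtain ⟨w, h1, h2, -⟩ := D.arc_inter_arc _ _ h x ⟨hx, hx'⟩
      refine ⟨w, ?_, ?_⟩
      · rcases Sym2.mem_iff.1 h1 with rfl | rfl <;> assumption
      · rcases Sym2.mem_iff.1 h2 with rfl | rfl <;> assumption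

theorem pos_mem_region (D : PlaneDrawing G) {S : Set V} {v : V} (h : v ∈ S) :
    D.pos v ∈ D.region S := Or.inl ⟨v, h, rfl⟩

theorem exists_path_region_of_adj (D : PlaneDrawing G) {u v : V} (h : G.Adj u v) :
    ∃ γ : Path (D.pos u) (D.pos v), ∀ t, γ t ∈ D.region {u, v} := by
  obtain ⟨γ, -, hγ⟩ := D.isArc u v h
  exact ⟨γ, fun t => Or.inr ⟨u, v, h, by simp, by simp, hγ ▸ Set.mem_range_self t⟩⟩

theorem exists_path_region_of_walk (D : PlaneDrawing G) {g : ℕ → V}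
    (hg : ∀ k, G.Adj (g k) (g (k + 1))) {i j : ℕ} (hij : i ≤ j) :
    ∃ γ : Path (D.pos (g i)) (D.pos (g j)), ∀ t, γ t ∈ D.region (g '' Set.Icc i j) := by
  induction j, hij using Nat.le_induction with
  | base => exact ⟨Path.refl _, fun t => D.pos_mem_region ⟨i, by simp, rfl⟩⟩
  | succ j hij ih =>
    obtain ⟨γ, hγ⟩ := ih
    obtain ⟨δ, hδ⟩ := D.exists_path_region_of_adj (hg j)
    refine ⟨γ.trans δ, fun t => ?_⟩
    have : γ.trans δ t ∈ Set.range (γ.trans δ) := Set.mem_range_self t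
    rw [Path.trans_range] at this
    rcases this with ⟨s, hs⟩ | ⟨s, hs⟩
    · rw [← hs]
      exact D.region_mono (Set.image_mono (Set.Icc_subset_Icc_right (Nat.le_succ j))) (hγ s)
    · rw [← hs]
      refine D.region_mono ?_ (hδ s)
      rintro x (rfl | rfl)
      exacts [⟨j, ⟨hij, Nat.le_succ j⟩, rfl⟩, ⟨j + 1, ⟨hij.trans (Nat.le_succ j), le_rfl⟩, rfl⟩]

end PlaneDrawing

/-- The plane as the complex plane. -/
noncomputable def planeToComplex : Plane ≃ₗᵢ[ℝ] ℂ := Complex.orthonormalBasisOneI.repr.symm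

/-- A triangle in a drawing does not wind around a vertex outside it that lies on the boundary of
the outer face. -/
theorem PlaneDrawing.triangle_logVar_eq_zero {V : Type*} {G : SimpleGraph V} (D : PlaneDrawing G)
    {F : Set Plane} (hF : D.IsOuterFace F) {w : V} (hw : D.pos w ∈ frontier F) {S : Set V}
    (hS : w ∉ S) {a b c : Plane} (p : Path a b) (q : Path b c) (r : Path a c)
    (hp : ∀ t, p t ∈ D.region S) (hq : ∀ t, q t ∈ D.region S) (hr : ∀ t, r t ∈ D.region S) :
    logVar (fun t => planeToComplex (p.extend t) - planeToComplex (D.pos w)) +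
      logVar (fun t => planeToComplex (q.extend t) - planeToComplex (D.pos w)) -
      logVar (fun t => planeToComplex (r.extend t) - planeToComplex (D.pos w)) = 0 := by
  obtain ⟨⟨x, hx, hFx⟩, hub⟩ := hF
  set K : Set Plane := Set.range p ∪ Set.range q ∪ Set.range r
  have hKS : K ⊆ D.region S := by
    rintro y ((⟨t, rfl⟩ | ⟨t, rfl⟩) | ⟨t, rfl⟩)
    exacts [hp t, hq t, hr t]
  have hK : IsCompact K := ((isCompact_range p.continuous).union
    (isCompact_range q.continuous)).union (isCompact_range r.continuous)
  have hwK : D.pos w ∈ Kᶜ := fun h => by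
    obtain ⟨v, hv, hv'⟩ := D.exists_mem_of_mem_region (hKS h)
      (D.pos_mem_region (Set.mem_singleton w))
    exact hS (Set.mem_singleton_iff.1 hv' ▸ hv)
  have hFK : F ⊆ Kᶜ := by
    rw [hFx]
    exact (connectedComponentIn_subset _ _).trans
      (Set.compl_subset_compl.2 (hKS.trans (D.region_subset_support S)))
  have hUo : IsOpen Kᶜ := hK.isClosed.isOpen_compl
  obtain ⟨ε, hε, hball⟩ := Metric.isOpen_iff.1 hUo _ hwK
  obtain ⟨z, hzF, hz⟩ := Metric.mem_closure_iff.1 hw.1 ε hε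
  obtain ⟨R, hR⟩ := hK.isBounded.exists_norm_le
  obtain ⟨y, hyF, hy⟩ : ∃ y ∈ F, R < ‖y‖ := by
    by_contra! h
    exact hub (isBounded_iff_forall_norm_le.2 ⟨R, h⟩)
  -- A small disk around the vertex meets the outer face, so their union lies in a single component
  -- of the complement of the triangle. This gives a path from the vertex to a far point.
  have hconn : IsPreconnected (Metric.ball (D.pos w) ε ∪ F) := by
    refine IsPreconnected.union z (Metric.mem_ball'.2 hz) hzF
      (convex_ball _ _).isPreconnected ?_
    rw [hFx]
    exact isPreconnected_connectedComponentIn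
  have hCsub := hconn.subset_connectedComponentIn (Or.inl (Metric.mem_ball_self hε))
    (Set.union_subset hball hFK)
  have hC : IsPathConnected (connectedComponentIn Kᶜ (D.pos w)) :=
    (hUo.connectedComponentIn.isConnected_iff_isPathConnected).1
      (isConnected_connectedComponentIn_iff.2 hwK)
  obtain ⟨σ, hσ⟩ := hC.joinedIn _ (mem_connectedComponentIn hwK) y (hCsub (Or.inr hyF))
  have hσK : ∀ s, σ.extend s ∉ K := fun s =>
    connectedComponentIn_subset _ _ (hσ _)
  have mp : ∀ t, p.extend t ∈ K := fun t => Or.inl (Or.inl ⟨_, rfl⟩)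
  have mq : ∀ t, q.extend t ∈ K := fun t => Or.inl (Or.inr ⟨_, rfl⟩)
  have mr : ∀ t, r.extend t ∈ K := fun t => Or.inr ⟨_, rfl⟩
  have ne : ∀ {u : Plane} {s : ℝ}, u ∈ K → planeToComplex u ≠ planeToComplex (σ.extend s) :=
    fun {u s} hu h => hσK s (planeToComplex.injective h ▸ hu)
  have far : ∀ {u : Plane}, u ∈ K → ‖planeToComplex u‖ < ‖planeToComplex y‖ := fun hu => by
    rw [planeToComplex.norm_map, planeToComplex.norm_map]
    exact (hR _ hu).trans_lt hy
  have cont : ∀ {a b : Plane} (γ : Path a b), Continuous fun t => planeToComplex (γ.extend t) :=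
    fun γ => planeToComplex.continuous.comp γ.continuous_extend
  have e1 := triangle_logVar_move (cont p) (cont q) (cont r) (cont σ) (fun t s => ne (mp t))
    (fun t s => ne (mq t)) (fun t s => ne (mr t)) (by simp) (by simp) (by simp)
  have e2 := triangle_logVar_far (x := planeToComplex y) (cont p) (cont q) (cont r)
    (fun t => far (mp t)) (fun t => far (mq t)) (fun t => far (mr t)) (by simp) (by simp) (by simp)
  simp only [Path.extend_zero, Path.extend_one] at e1
  rw [e1, e2]

/-- A labelling of the vertices along a Hamiltonian cycle, extended periodically. -/
structure IsCyclicLabelling {V : Type*} (G : SimpleGraph V) (n : ℕ) (g : ℕ → V) : Prop where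
  three_le : 3 ≤ n
  periodic : ∀ k, g (k + n) = g k
  inj : ∀ i j, i < j → j < i + n → g i ≠ g j
  surj : ∀ v, ∃ i < n, g i = v
  adj : ∀ k, G.Adj (g k) (g (k + 1))

/-- Two chords of an outerplanar graph with a Hamiltonian cycle do not cross. -/
theorem IsOuterplanar.not_crossing {V : Type*} {G : SimpleGraph V} (hG : IsOuterplanar G) {n : ℕ}
    {g : ℕ → V} (hg : IsCyclicLabelling G n g) {i j k l : ℕ} (hij : i < j) (hjk : j < k)
    (hkl : k < l) (hli : l < i + n) (h1 : G.Adj (g i) (g k)) (h2 : G.Adj (g j) (g l)) : False := by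
  obtain ⟨D, F, hF, hfr⟩ := hG
  obtain ⟨ab, hab⟩ := D.exists_path_region_of_walk hg.adj hij.le
  obtain ⟨bc, hbc⟩ := D.exists_path_region_of_walk hg.adj hjk.le
  obtain ⟨cd, hcd⟩ := D.exists_path_region_of_walk hg.adj hkl.le
  obtain ⟨da, hda⟩ := D.exists_path_region_of_walk hg.adj hli.le
  obtain ⟨ac, hac⟩ := D.exists_path_region_of_adj h1
  obtain ⟨bd, hbd⟩ := D.exists_path_region_of_adj h2
  obtain ⟨ad, had⟩ : ∃ γ : Path (D.pos (g i)) (D.pos (g l)),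
      ∀ t, γ t ∈ D.region (g '' Set.Icc l (i + n)) :=
    ⟨da.symm.cast (by rw [hg.periodic]) rfl, fun t => hda _⟩
  -- In the window from `i` to `i + n` only the two extreme positions carry the same vertex.
  have inj : ∀ x y, i ≤ x → x < y → y ≤ i + n → g x = g y → x = i ∧ y = i + n := by
    intro x y hx hxy hy h
    by_contra hne
    exact hg.inj x y hxy (by omega) h
  have key : ∀ x y, i ≤ x → x ≤ i + n → i ≤ y → y ≤ i + n → g x = g y →
      x = y ∨ (x = i ∧ y = i + n) ∨ (y = i ∧ x = i + n) := by
    intro x y hx hx' hy hy' h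
    rcases lt_trichotomy x y with h' | h' | h'
    · exact Or.inr (Or.inl (inj x y hx h' hy' h))
    · exact Or.inl h'
    · exact Or.inr (Or.inr (inj y x hy h' hx' h.symm))
  have disj : ∀ {S T : Set V} {a b c d : Plane} {p : Path a b} {q : Path c d},
      (∀ t, p t ∈ D.region S) → (∀ t, q t ∈ D.region T) → (∀ v ∈ S, v ∉ T) →
      ∀ s t, planeToComplex (p.extend s) ≠ planeToComplex (q.extend t) := by
    intro S T a b c d p q hp hq hST s t h
    have h' : p.extend s = q.extend t := planeToComplex.injective h
    obtain ⟨v, hv, hv'⟩ := D.exists_mem_of_mem_region (hp _) (h' ▸ hq _)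
    exact hST v hv hv'
  have cont : ∀ {a b : Plane} (γ : Path a b), Continuous fun t => planeToComplex (γ.extend t) :=
    fun γ => planeToComplex.continuous.comp γ.continuous_extend
  have tri : ∀ {S₁ S₂ S₃ : Set V} {a b c : Plane} {p : Path a b} {q : Path b c} {r : Path a c}
      {w : V}, (∀ t, p t ∈ D.region S₁) → (∀ t, q t ∈ D.region S₂) → (∀ t, r t ∈ D.region S₃) →
      w ∉ S₁ → w ∉ S₂ → w ∉ S₃ →
      logVar (fun t => planeToComplex (p.extend t) - planeToComplex (D.pos w)) +
      logVar (fun t => planeToComplex (q.extend t) - planeToComplex (D.pos w)) -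
      logVar (fun t => planeToComplex (r.extend t) - planeToComplex (D.pos w)) = 0 := by
    intro S₁ S₂ S₃ a b c p q r w hp hq hr h₁ h₂ h₃
    refine D.triangle_logVar_eq_zero hF (hfr w) (S := S₁ ∪ S₂ ∪ S₃) (by simp [h₁, h₂, h₃]) p q r
      (fun t => D.region_mono (by intro; simp +contextual) (hp t))
      (fun t => D.region_mono (by intro; simp +contextual) (hq t))
      (fun t => D.region_mono (by intro; simp +contextual) (hr t))
  refine k4_winding (cont ab) (cont ac) (cont ad) (cont bc) (cont bd) (cont cd)
    (a := planeToComplex (D.pos (g i))) (b := planeToComplex (D.pos (g j)))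
    (c := planeToComplex (D.pos (g k))) (d := planeToComplex (D.pos (g l)))
    (by simp) (by simp) (by simp) (by simp) (by simp) (by simp) (by simp) (by simp) (by simp)
    (by simp) (by simp) (by simp) (disj hab hcd ?_) (disj hac hbd ?_) (disj had hbc ?_)
    (tri hab hbc hac ?_ ?_ ?_) (tri hab hbd had ?_ ?_ ?_) (tri hac hcd had ?_ ?_ ?_)
    (tri hbc hcd hbd ?_ ?_ ?_)
  · rintro _ ⟨x, hx, rfl⟩ ⟨y, hy, h⟩
    simp only [Set.mem_Icc] at hx hy
    have := key x y (by omega) (by omega) (by omega) (by omega) h.symm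
    omega
  · rintro _ (rfl | rfl) (h | h)
    · have := key _ _ (by omega) (by omega) (by omega) (by omega) h
      omega
    · have := key _ _ (by omega) (by omega) (by omega) (by omega) h
      omega
    · have := key _ _ (by omega) (by omega) (by omega) (by omega) h
      omega
    · have := key _ _ (by omega) (by omega) (by omega) (by omega) h
      omega
  · rintro _ ⟨x, hx, rfl⟩ ⟨y, hy, h⟩
    simp only [Set.mem_Icc] at hx hy
    have := key x y (by omega) (by omega) (by omega) (by omega) h.symm
    omega
  all_goals
    first
    | rintro ⟨y, hy, h⟩
      simp only [Set.mem_Icc] at hy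
      have := key _ _ (by omega) (by omega) (by omega) (by omega) h
      omega
    | rintro (h | h)
      · have := key _ _ (by omega) (by omega) (by omega) (by omega) h
        omega
      · have := key _ _ (by omega) (by omega) (by omega) (by omega) h
        omega

/-! ### Polygons inscribed in the unit circle -/

/-- The point of the unit circle at the angle `2 * t`. -/
noncomputable def circlePoint (t : ℝ) : Plane := !₂[Real.cos (2 * t), Real.sin (2 * t)]

theorem circlePoint_pi : circlePoint Real.pi = circlePoint 0 := by
  simp [circlePoint]

/-- In product form the sign can be read off from the order of the parameters, which makes strict
convexity a matter of signs of sines. -/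
theorem signedArea_circlePoint (a b c : ℝ) :
    signedArea (circlePoint a) (circlePoint b) (circlePoint c) =
      4 * Real.sin (b - a) * Real.sin (c - b) * Real.sin (c - a) := by
  have e1 : signedArea (circlePoint a) (circlePoint b) (circlePoint c) =
      Real.sin (2 * (b - a)) + Real.sin (2 * (c - b)) - Real.sin (2 * (b - a) + 2 * (c - b)) := by
    have h1 : 2 * (b - a) = 2 * b - 2 * a := by ring
    have h2 : 2 * (c - b) = 2 * c - 2 * b := by ring
    have h3 : 2 * b - 2 * a + (2 * c - 2 * b) = 2 * c - 2 * a := by ring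
    rw [h1, h2, h3, Real.sin_sub, Real.sin_sub, Real.sin_sub]
    simp [signedArea, circlePoint]
    ring
  have e2 : c - a = (b - a) + (c - b) := by ring
  rw [e1, e2, Real.sin_add, Real.sin_add, Real.sin_two_mul, Real.sin_two_mul, Real.cos_two_mul,
    Real.cos_two_mul]
  have h1 := Real.sin_sq_add_cos_sq (b - a)
  have h2 := Real.sin_sq_add_cos_sq (c - b)
  linear_combination -4 * Real.sin (b - a) * Real.cos (b - a) * h2 -
    4 * Real.sin (c - b) * Real.cos (c - b) * h1

theorem dist_circlePoint {a b : ℝ} (h : a ≤ b) (h' : b ≤ a + Real.pi) :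
    dist (circlePoint a) (circlePoint b) = 2 * Real.sin (b - a) := by
  have hs : 0 ≤ Real.sin (b - a) :=
    Real.sin_nonneg_of_nonneg_of_le_pi (by linarith) (by linarith)
  rw [EuclideanSpace.dist_eq, Real.sqrt_eq_iff_mul_self_eq (by positivity) (by positivity)]
  simp only [Fin.sum_univ_two, Real.dist_eq, sq_abs]
  have e : Real.cos (2 * (b - a)) = Real.cos (2 * b - 2 * a) := by ring_nf
  rw [Real.cos_sub, Real.cos_two_mul] at e
  simp [circlePoint]
  have h1 := Real.sin_sq_add_cos_sq (b - a)
  have h2 := Real.sin_sq_add_cos_sq (2 * a)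
  have h3 := Real.sin_sq_add_cos_sq (2 * b)
  linear_combination h2 + h3 + 2 * e - 4 * h1

/-- The condition for the side disks of two sides of a polygon inscribed in the unit circle to have
a point in common; `α` and `β` are half the central angles of the sides, and `ω` is the angle
between the directions of their midpoints. -/
def DisksMeet (α β ω : ℝ) : Prop :=
  Real.cos α ^ 2 - Real.sin β ^ 2 ≤
    Real.cos α * Real.cos β * Real.cos ω + Real.sin α * Real.sin β

theorem closedBall_inter_closedBall_nonempty_iff {x y : Plane} {r s : ℝ} (hr : 0 ≤ r)
    (hs : 0 ≤ s) : (Metric.closedBall x r ∩ Metric.closedBall y s).Nonempty ↔ dist x y ≤ r + s := by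
  constructor
  · rintro ⟨z, hx, hy⟩
    rw [Metric.mem_closedBall] at hx hy
    linarith [dist_triangle_left x y z]
  · intro h
    obtain ⟨z, h1, h2⟩ := exists_dist_le_le hr hs (by linarith)
    exact ⟨z, by rwa [Metric.mem_closedBall'], by simpa⟩

/-- The midpoint of a chord has signed distance `cos (b - a)` from the centre in direction `a + b`;
the rest is the law of cosines. -/
theorem dist_midpoint_circlePoint_sq (a b c d : ℝ) :
    dist (midpoint ℝ (circlePoint a) (circlePoint b)) (midpoint ℝ (circlePoint c) (circlePoint d))
      ^ 2 = Real.cos (b - a) ^ 2 + Real.cos (d - c) ^ 2 -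
        2 * Real.cos (b - a) * Real.cos (d - c) * Real.cos (c + d - a - b) := by
  have key : ∀ a b : ℝ, midpoint ℝ (circlePoint a) (circlePoint b) =
      !₂[Real.cos (b - a) * Real.cos (a + b), Real.cos (b - a) * Real.sin (a + b)] := by
    intro a b
    have e1 : 2 * a = (a + b) - (b - a) := by ring
    have e2 : 2 * b = (a + b) + (b - a) := by ring
    ext i
    fin_cases i
    · simp [midpoint_eq_smul_add, circlePoint]
      rw [e1, e2, Real.cos_sub (a + b), Real.cos_add (a + b)]; ring
    · simp [midpoint_eq_smul_add, circlePoint]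
      rw [e1, e2, Real.sin_sub (a + b), Real.sin_add (a + b)]; ring
  rw [key, key, EuclideanSpace.dist_eq, Real.sq_sqrt (by positivity)]
  have e : c + d - a - b = (c + d) - (a + b) := by ring
  simp only [Fin.sum_univ_two, Real.dist_eq, sq_abs]
  rw [e, Real.cos_sub (c + d)]
  simp
  have h1 := Real.sin_sq_add_cos_sq (a + b)
  have h2 := Real.sin_sq_add_cos_sq (c + d)
  linear_combination Real.cos (b - a) ^ 2 * h1 + Real.cos (d - c) ^ 2 * h2

/-- A convex polygon inscribed in the unit circle, with prescribed central angles `2 * α i`. -/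
theorem exists_inscribed_polygon {n : ℕ} (hn : 3 ≤ n) {α : ℕ → ℝ} (hα : ∀ i < n, 0 < α i)
    (hs : ∑ i ∈ Finset.range n, α i = Real.pi) :
    ∃ P : Polygon Plane n, P.IsConvexCCW ∧ ∀ i j : Fin n, i < j →
      ((P.sideDisk i ∩ P.sideDisk j).Nonempty ↔
        DisksMeet (α i) (α j) (α i + α j + 2 * ∑ v ∈ Finset.Ico (i + 1 : ℕ) j, α v)) := by
  set t : ℕ → ℝ := fun j => ∑ i ∈ Finset.range j, α i with ht
  have tsucc : ∀ i, t (i + 1) = t i + α i := fun i => Finset.sum_range_succ _ _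
  have tn : t n = Real.pi := hs
  have tlt : ∀ i j, i < j → j ≤ n → t i < t j := by
    intro i j hij hj
    exact Finset.sum_lt_sum_of_subset (i := i) (Finset.range_mono hij.le) (by simpa) (by simp)
      (hα i (by omega)) fun k hk _ => (hα k (by simp at hk; omega)).le
  have t0 : t 0 = 0 := by simp [ht]
  have tnn : ∀ i ≤ n, 0 ≤ t i := fun i hi => by
    rcases Nat.eq_zero_or_pos i with rfl | h
    · exact t0.ge
    · exact t0 ▸ (tlt 0 i h hi).le
  have tpi : ∀ i < n, t i < Real.pi := fun i hi => tn ▸ tlt i n hi le_rfl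
  let P : Polygon Plane n := ⟨fun i => circlePoint (t i)⟩
  have hP : ∀ i : Fin n, P i = circlePoint (t i) := fun i => rfl
  -- The last side closes up because `circlePoint` takes the same value at π and at 0.
  have hrot : ∀ i : Fin n, P (finRotate n i) = circlePoint (t (i + 1)) := by
    intro i
    obtain ⟨m, rfl⟩ : ∃ m, n = m + 1 := ⟨n - 1, by omega⟩
    rcases eq_or_ne i (Fin.last m) with rfl | hi
    · rw [finRotate_last, hP, Fin.val_last, tn, circlePoint_pi]
      simp [t0]
    · rw [hP, coe_finRotate_of_ne_last hi]
  have hαpi : ∀ i < n, α i < Real.pi := fun i hi => by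
    rcases Nat.lt_or_ge (i + 1) n with h | h
    · linarith [tsucc i, tpi (i + 1) h, tnn i hi.le]
    · have : i + 1 = n := by omega
      have h1 := tlt 0 i (by omega) hi.le
      have h2 := tsucc i
      rw [this, tn] at h2
      linarith
  have hsin : ∀ i < n, 0 < Real.sin (α i) := fun i hi =>
    Real.sin_pos_of_pos_of_lt_pi (hα i hi) (hαpi i hi)
  refine ⟨P, ⟨hn, fun i k hki hki' => ?_⟩, fun i j hij => ?_⟩
  · rw [hrot, hP, hP, signedArea_circlePoint, tsucc, add_sub_cancel_left]
    have hk : (k : ℕ) ≠ i := fun h => hki (Fin.ext h)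
    rcases lt_or_gt_of_ne hk with h | h
    · have h1 : t k - (t i + α i) < 0 := by linarith [tlt k i h i.2.le, hα i i.2]
      have h2 : -Real.pi < t k - (t i + α i) := by
        rw [← tsucc]
        rcases Nat.eq_zero_or_pos (k : ℕ) with h0 | h0
        · have : (i + 1 : ℕ) ≠ n := by
            intro h'
            apply hki'
            obtain ⟨m, rfl⟩ : ∃ m, n = m + 1 := ⟨n - 1, by omega⟩
            have : i = Fin.last m := Fin.ext (by simp; omega)
            rw [this, finRotate_last]
            exact Fin.ext h0
          have := tpi (i + 1) (by omega)
          linarith [tnn k k.2.le]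
        · have := tlt 0 k h0 k.2.le
          rcases Nat.lt_or_ge (i + 1) n with h' | h'
          · linarith [tpi (i + 1) h']
          · have h'' : (i + 1 : ℕ) = n := by omega
            rw [h'', tn]; linarith
      have h3 : t k - t i < 0 := by linarith [tlt k i h i.2.le]
      have h4 := Real.sin_neg_of_neg_of_neg_pi_lt h1 h2
      have h5 := Real.sin_neg_of_neg_of_neg_pi_lt h3 (by linarith [hα i i.2])
      have := mul_pos_of_neg_of_neg h4 h5
      have := mul_pos (hsin i i.2) this
      linarith
    · have hk1 : (k : ℕ) ≠ i + 1 := by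
        intro h'
        apply hki'
        obtain ⟨m, rfl⟩ : ∃ m, n = m + 1 := ⟨n - 1, by omega⟩
        refine Fin.ext ?_
        rw [coe_finRotate_of_ne_last, h']
        intro h2
        rw [h2, Fin.val_last] at h
        omega
      have h1 : 0 < t k - (t i + α i) := by
        rw [← tsucc]; linarith [tlt (i + 1) k (by omega) k.2.le]
      have h2 := tpi k k.2
      have h3 := tnn i i.2.le
      have h4 := hα i i.2
      have h5 := Real.sin_pos_of_pos_of_lt_pi h1 (by linarith)
      have h6 : 0 < Real.sin (t k - t i) :=
        Real.sin_pos_of_pos_of_lt_pi (by linarith) (by linarith)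
      have := hsin i i.2
      positivity
  · have hdist : ∀ i : Fin n, dist (P i) (P (finRotate n i)) / 2 = Real.sin (α i) := by
      intro i
      have := hα i i.2
      have := hαpi i i.2
      rw [hrot, hP, tsucc, dist_circlePoint (by linarith) (by linarith)]
      simp
    have h1 := hsin i i.2
    have h2 := hsin j j.2
    rw [Polygon.sideDisk, Polygon.sideDisk, hdist, hdist,
      closedBall_inter_closedBall_nonempty_iff h1.le h2.le,
      ← sq_le_sq₀ dist_nonneg (by positivity), hrot, hrot, hP, hP, dist_midpoint_circlePoint_sq,
      Finset.sum_Ico_eq_sub _ (by omega : (i + 1 : ℕ) ≤ j)]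
    change _ ↔ DisksMeet _ _ (_ + _ + 2 * (t j - t (i + 1)))
    rw [tsucc, tsucc, add_sub_cancel_left, add_sub_cancel_left, DisksMeet]
    have e : t j + (t j + α j) - t i - (t i + α i) = α i + α j + 2 * (t j - (t i + α i)) := by ring
    rw [e]
    have h3 := Real.sin_sq_add_cos_sq (α i)
    have h4 := Real.sin_sq_add_cos_sq (α j)
    constructor <;> intro h <;> nlinarith

/-! ### Criteria for contact of two side disks -/

theorem disksMeet_comm {α β ω : ℝ} : DisksMeet α β ω ↔ DisksMeet β α ω := by
  have h1 := Real.sin_sq_add_cos_sq α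
  have h2 := Real.sin_sq_add_cos_sq β
  unfold DisksMeet
  constructor <;> intro h <;> linarith

/-- The angle `α + 3 * β` is the case of an arc of half-angle `β` between the sides. There the
contact inequality fails by `sin β` times a combination of `sin α` and `sin β` whose coefficients
are positive by `h1` and `h2`. -/
theorem not_disksMeet_of_cos_le {α β ω : ℝ} (hα : 0 ≤ Real.sin α) (hβ : 0 < Real.sin β)
    (hα' : 0 ≤ Real.cos α) (hβ' : 0 ≤ Real.cos β)
    (h1 : 1 < Real.cos α * Real.cos β * (4 * Real.cos β ^ 2 - 1))
    (h2 : 1 < Real.cos α ^ 2 * (4 * Real.cos β ^ 2 + 1))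
    (hω : Real.cos ω ≤ Real.cos (α + 3 * β)) : ¬ DisksMeet α β ω := by
  intro h
  unfold DisksMeet at h
  have h3 := mul_le_mul_of_nonneg_left hω (mul_nonneg hα' hβ')
  rw [Real.cos_add, Real.cos_three_mul, Real.sin_three_mul] at h3
  have ha := Real.sin_sq_add_cos_sq α
  have hb := Real.sin_sq_add_cos_sq β
  have e : Real.cos α ^ 2 - Real.sin β ^ 2 - Real.sin α * Real.sin β - Real.cos α * Real.cos β *
      (Real.cos α * (4 * Real.cos β ^ 3 - 3 * Real.cos β) -
        Real.sin α * (3 * Real.sin β - 4 * Real.sin β ^ 3)) =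
      Real.sin β * (Real.sin α * (Real.cos α * Real.cos β * (4 * Real.cos β ^ 2 - 1) - 1) +
        Real.sin β * (Real.cos α ^ 2 * (4 * Real.cos β ^ 2 + 1) - 1)) := by
    generalize Real.sin α = a at *
    generalize Real.sin β = b at *
    generalize Real.cos α = c at *
    generalize Real.cos β = d at *
    have hb' : b ^ 2 = 1 - d ^ 2 := by linarith
    have hb3 : b ^ 3 = b * (1 - d ^ 2) := by rw [← hb']; ring
    rw [hb3]
    linear_combination (-c ^ 2 * (4 * d ^ 2 + 1)) * hb'
  have p1 : 0 ≤ Real.sin α * (Real.cos α * Real.cos β * (4 * Real.cos β ^ 2 - 1) - 1) :=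
    mul_nonneg hα (by linarith)
  have p2 : 0 < Real.sin β * (Real.cos α ^ 2 * (4 * Real.cos β ^ 2 + 1) - 1) :=
    mul_pos hβ (by linarith)
  have := mul_pos hβ (add_pos_of_nonneg_of_pos p1 p2)
  linarith

theorem cos_le_cos_of_le_of_le_two_pi_sub {x y : ℝ} (hx : 0 ≤ x) (h1 : x ≤ y)
    (h2 : y ≤ 2 * Real.pi - x) : Real.cos y ≤ Real.cos x := by
  rcases le_total y Real.pi with h | h
  · exact Real.cos_le_cos_of_nonneg_of_le_pi hx h h1
  · rw [← Real.cos_two_pi_sub y]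
    exact Real.cos_le_cos_of_nonneg_of_le_pi hx (by linarith) (by linarith)

/-- Two sides do not meet if they are separated in both directions by at least the length of
one of them. -/
theorem not_disksMeet_of_gap {α β σ : ℝ} (hα : 0 < α) (hβ : 0 < β) (hα' : α ≤ Real.pi / 2)
    (hβ' : β ≤ Real.pi / 2) (h1 : 1 < Real.cos α * Real.cos β * (4 * Real.cos β ^ 2 - 1))
    (h2 : 1 < Real.cos α ^ 2 * (4 * Real.cos β ^ 2 + 1)) (hσ : β ≤ σ)
    (hσ' : β ≤ Real.pi - (α + β + σ)) : ¬ DisksMeet α β (α + β + 2 * σ) := by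
  have hπ := Real.pi_pos
  refine not_disksMeet_of_cos_le
    (Real.sin_nonneg_of_nonneg_of_le_pi hα.le (by linarith))
    (Real.sin_pos_of_pos_of_lt_pi hβ (by linarith))
    (Real.cos_nonneg_of_neg_pi_div_two_le_of_le (by linarith) hα')
    (Real.cos_nonneg_of_neg_pi_div_two_le_of_le (by linarith) hβ') h1 h2
    (cos_le_cos_of_le_of_le_two_pi_sub (by linarith) (by linarith) (by linarith))

/-- Two sides meet if the arc between them is very short. -/
theorem disksMeet_of_gap {α β σ : ℝ} (hα : 0 ≤ Real.cos α) (hβ : 0 ≤ Real.cos β) (hσ : 0 ≤ σ)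
    (h : 2 * σ ≤ Real.sin α * Real.sin β * (1 - Real.cos (α + β))) :
    DisksMeet α β (α + β + 2 * σ) := by
  unfold DisksMeet
  have h1 : Real.cos (α + β) - 2 * σ ≤ Real.cos (α + β + 2 * σ) := by
    have := Real.abs_cos_sub_cos_le (α + β) (α + β + 2 * σ)
    rw [sub_add_cancel_left, abs_neg, abs_of_nonneg (by positivity : 0 ≤ 2 * σ)] at this
    linarith [le_abs_self (Real.cos (α + β) - Real.cos (α + β + 2 * σ))]
  have hle : Real.cos α * Real.cos β ≤ 1 :=
    mul_le_one₀ (Real.cos_le_one _) hβ (Real.cos_le_one _)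
  have h2 := mul_le_mul_of_nonneg_left h1 (mul_nonneg hα hβ)
  have h3 : Real.cos α * Real.cos β * (2 * σ) ≤ 2 * σ :=
    mul_le_of_le_one_left (by positivity) hle
  -- The slack for sides with a common end; as cosine is 1-Lipschitz, an arc `σ` uses up at most `2
  -- * σ` of it.
  have e : Real.cos α * Real.cos β * Real.cos (α + β) + Real.sin α * Real.sin β -
      (Real.cos α ^ 2 - Real.sin β ^ 2) = Real.sin α * Real.sin β * (1 - Real.cos (α + β)) := by
    rw [Real.cos_add]
    have ha := Real.sin_sq_add_cos_sq α
    have hb := Real.sin_sq_add_cos_sq β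
    have ha' : Real.sin α ^ 2 = 1 - Real.cos α ^ 2 := by linarith
    have hb' : Real.sin β ^ 2 = 1 - Real.cos β ^ 2 := by linarith
    linear_combination (-Real.sin β ^ 2) * ha' + Real.cos α ^ 2 * hb'
  linarith

/-- Two equal long sides meet. -/
theorem disksMeet_self {α ω : ℝ} (h1 : Real.pi / 4 ≤ α) (h2 : α ≤ Real.pi / 2) :
    DisksMeet α α ω := by
  unfold DisksMeet
  -- This says that the radius `sin α` is at least the distance `cos α` to the centre of the circle,
  -- so both disks contain that centre.
  have h3 : Real.cos (2 * α) ≤ 0 :=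
    Real.cos_nonpos_of_pi_div_two_le_of_le (by linarith) (by linarith)
  rw [Real.cos_two_mul'] at h3
  have := mul_le_mul_of_nonneg_left (Real.neg_one_le_cos ω) (mul_self_nonneg (Real.cos α))
  nlinarith

/-- Two sides that are not too long and that are separated in both directions by at least the
length of one of them do not meet. -/
theorem not_disksMeet_of_short {α β σ : ℝ} (hα : 0 < α) (hβ : 0 < β)
    (hαβ : α ≤ Real.pi / 5 ∧ β ≤ Real.pi / 5 ∧ α = β ∨ α ≤ Real.pi / 6 ∧ β ≤ Real.pi / 6 ∨
      α ≤ Real.pi / 3 ∧ β ≤ Real.pi / 9)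
    (hσ : β ≤ σ) (hσ' : β ≤ Real.pi - (α + β + σ)) : ¬ DisksMeet α β (α + β + 2 * σ) := by
  have hπ := Real.pi_pos
  have hπ' := Real.pi_lt_d2
  have cosle : ∀ {x y : ℝ}, 0 < x → x ≤ y → y ≤ Real.pi / 2 → Real.cos y ≤ Real.cos x :=
    fun hx hxy hy => Real.cos_le_cos_of_nonneg_of_le_pi hx.le (by linarith) hxy
  rcases hαβ with ⟨h1, h2, rfl⟩ | ⟨h1, h2⟩ | ⟨h1, h2⟩
  -- Equal sides up to π/5 satisfy the required inequalities with a small margin; π/4 does not, so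
  -- the square is excluded.
  · have hs : (2.236 : ℝ) ≤ Real.sqrt 5 := Real.le_sqrt_of_sq_le (by norm_num)
    have hc := cosle hα h1 (by linarith)
    rw [Real.cos_pi_div_five] at hc
    have hc2 : 0.654 ≤ Real.cos α ^ 2 := by nlinarith
    refine not_disksMeet_of_gap hα hβ (by linarith) (by linarith) ?_ ?_ hσ hσ'
    · nlinarith
    · nlinarith
  · have hs : Real.sqrt 3 * Real.sqrt 3 = 3 := Real.mul_self_sqrt (by norm_num)
    have ha := cosle hα h1 (by linarith)
    have hb := cosle hβ h2 (by linarith)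
    rw [Real.cos_pi_div_six] at ha hb
    have h3 : 0 < Real.sqrt 3 := by positivity
    have hab : 3 / 4 ≤ Real.cos α * Real.cos β := by nlinarith
    have hb2 : 3 / 4 ≤ Real.cos β ^ 2 := by nlinarith
    have ha2 : 3 / 4 ≤ Real.cos α ^ 2 := by nlinarith
    refine not_disksMeet_of_gap hα hβ (by linarith) (by linarith) ?_ ?_ hσ hσ' <;> nlinarith
  · have ha := cosle hα h1 (by linarith)
    rw [Real.cos_pi_div_three] at ha
    have hc : 0.93 ≤ Real.cos β := by
      have := Real.one_sub_sq_div_two_le_cos (x := β)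
      nlinarith
    have hab : 0.465 ≤ Real.cos α * Real.cos β := by nlinarith
    have hb2 : 0.8649 ≤ Real.cos β ^ 2 := by nlinarith
    have ha2 : 1 / 4 ≤ Real.cos α ^ 2 := by nlinarith
    refine not_disksMeet_of_gap hα hβ (by linarith) (by linarith) ?_ ?_ hσ hσ' <;> nlinarith

/-! ### Realizing a graph with a Hamiltonian cycle by an inscribed polygon -/

/-- Allows the gap to be measured along either of the two arcs between the sides. -/
theorem disksMeet_two_pi_sub {α β ω : ℝ} : DisksMeet α β (2 * Real.pi - ω) ↔ DisksMeet α β ω := by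
  rw [DisksMeet, Real.cos_two_pi_sub, DisksMeet]

theorem IsCyclicLabelling.eq_iff {V : Type*} {G : SimpleGraph V} {n : ℕ} {g : ℕ → V}
    (hg : IsCyclicLabelling G n g) {i j : ℕ} (hi : i < n) (hj : j < n) : g i = g j ↔ i = j := by
  refine ⟨fun h => ?_, fun h => h ▸ rfl⟩
  rcases lt_trichotomy i j with h' | h' | h'
  · exact absurd h (hg.inj i j h' (by omega))
  · exact h'
  · exact absurd h.symm (hg.inj j i h' (by omega))

/-- The bijection between side indices and vertices given by a cyclic labelling. -/
noncomputable def IsCyclicLabelling.equiv {V : Type*} {G : SimpleGraph V} {n : ℕ} {g : ℕ → V}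
    (hg : IsCyclicLabelling G n g) : Fin n ≃ V :=
  Equiv.ofBijective (fun i => g i)
    ⟨fun i j h => Fin.ext ((hg.eq_iff i.2 j.2).1 h), fun v => by
      obtain ⟨i, hi, h⟩ := hg.surj v
      exact ⟨⟨i, hi⟩, h⟩⟩

theorem IsCyclicLabelling.shift {V : Type*} {G : SimpleGraph V} {n : ℕ} {g : ℕ → V}
    (hg : IsCyclicLabelling G n g) (a : ℕ) : IsCyclicLabelling G n (fun k => g (k + a)) where
  three_le := hg.three_le
  periodic k := by rw [add_right_comm, hg.periodic]
  inj i j hij hji := hg.inj _ _ (by omega) (by omega)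
  surj v := by
    have := hg.three_le
    have inj : Function.Injective fun i : Fin n => g (i + a) := by
      intro i j h
      by_contra hne
      rcases lt_or_gt_of_ne hne with h' | h'
      · exact hg.inj (i + a) (j + a) (by omega) (by omega) h
      · exact hg.inj (j + a) (i + a) (by omega) (by omega) h.symm
    have : Finite V := Finite.of_equiv _ hg.equiv
    obtain ⟨i, hi⟩ := (inj.bijective_of_nat_card_le
      (by rw [Nat.card_congr hg.equiv])).surjective v
    exact ⟨i, i.2, hi⟩
  adj k := by rw [add_right_comm]; exact hg.adj _

/-- A graph is realized by a polygon inscribed in the unit circle with central angles `2 * α i` if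
the arcs between adjacent sides are very short and those between other sides are long. -/
theorem IsCyclicLabelling.sideDiskRealizable {V : Type*} {G : SimpleGraph V} {n : ℕ} {g : ℕ → V}
    (hg : IsCyclicLabelling G n g) {α : ℕ → ℝ} (hα : ∀ i < n, 0 < α i)
    (hα' : ∀ i < n, α i ≤ Real.pi / 3) (hs : ∑ i ∈ Finset.range n, α i = Real.pi)
    (hadj : ∀ i j, i < j → j < n → G.Adj (g i) (g j) →
      2 * ∑ v ∈ Finset.Ico (i + 1) j, α v ≤
        Real.sin (α i) * Real.sin (α j) * (1 - Real.cos (α i + α j)) ∨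
      2 * (∑ v ∈ Finset.range i, α v + ∑ v ∈ Finset.Ico (j + 1) n, α v) ≤
        Real.sin (α i) * Real.sin (α j) * (1 - Real.cos (α i + α j)) ∨
      α i = α j ∧ Real.pi / 4 ≤ α i)
    (hnadj : ∀ i j, i < j → j < n → ¬ G.Adj (g i) (g j) → ∃ β γ : ℝ,
      (β = α i ∧ γ = α j ∨ β = α j ∧ γ = α i) ∧
      (γ ≤ Real.pi / 5 ∧ β ≤ Real.pi / 5 ∧ γ = β ∨ γ ≤ Real.pi / 6 ∧ β ≤ Real.pi / 6 ∨
        γ ≤ Real.pi / 3 ∧ β ≤ Real.pi / 9) ∧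
      (∃ v, i < v ∧ v < j ∧ β ≤ α v) ∧ ∃ v < n, (v < i ∨ j < v) ∧ β ≤ α v) :
    SideDiskRealizable G := by
  have hπ := Real.pi_pos
  obtain ⟨P, hP, hP'⟩ := exists_inscribed_polygon hg.three_le hα hs
  have hcos : ∀ i < n, 0 ≤ Real.cos (α i) := fun i hi =>
    Real.cos_nonneg_of_neg_pi_div_two_le_of_le (by linarith [hα i hi]) (by linarith [hα' i hi])
  have main : ∀ i j : Fin n, i < j →
      (G.Adj (g i) (g j) ↔ (P.sideDisk i ∩ P.sideDisk j).Nonempty) := by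
    intro i j hij
    rw [hP' i j hij]
    have split : ∑ v ∈ Finset.range i, α v + α i + ∑ v ∈ Finset.Ico (i + 1 : ℕ) j, α v + α j +
        ∑ v ∈ Finset.Ico (j + 1 : ℕ) n, α v = Real.pi := by
      rw [← hs, ← Finset.sum_range_succ, Finset.sum_range_add_sum_Ico _ (by omega),
        ← Finset.sum_range_succ, Finset.sum_range_add_sum_Ico _ (by omega)]
    have nn : ∀ s : Finset ℕ, (∀ v ∈ s, v < n) → 0 ≤ ∑ v ∈ s, α v := fun s h =>
      Finset.sum_nonneg fun v hv => (hα v (h v hv)).le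
    have nn1 := nn (Finset.range i) (by intro v hv; simp at hv; omega)
    have nn2 := nn (Finset.Ico (i + 1 : ℕ) j) (by intro v hv; simp at hv; omega)
    have nn3 := nn (Finset.Ico (j + 1 : ℕ) n) (by intro v hv; simp at hv; omega)
    have single : ∀ (s : Finset ℕ), (∀ v ∈ s, v < n) → ∀ v ∈ s, α v ≤ ∑ v ∈ s, α v :=
      fun s h v hv => Finset.single_le_sum (fun w hw => (hα w (h w hw)).le) hv
    constructor
    · intro h
      rcases hadj i j hij j.2 h with h1 | h1 | ⟨h1, h2⟩
      · exact disksMeet_of_gap (hcos i i.2) (hcos j j.2) nn2 h1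
      · rw [← disksMeet_two_pi_sub]
        have := disksMeet_of_gap (hcos i i.2) (hcos j j.2) (by positivity) h1
        convert! this using 1
        linarith
      · rw [← h1]
        exact disksMeet_self h2 (by linarith [hα' i i.2])
    · intro h
      by_contra hn
      obtain ⟨β, γ, h1, h2, ⟨v, hv1, hv2, hv3⟩, w, hwn, hw, hw'⟩ := hnadj i j hij j.2 hn
      have g1 : β ≤ ∑ v ∈ Finset.Ico (i + 1 : ℕ) j, α v :=
        hv3.trans (single _ (by intro v hv; simp at hv; omega) v (by simp; omega))
      have g2 : β ≤ ∑ v ∈ Finset.range i, α v + ∑ v ∈ Finset.Ico (j + 1 : ℕ) n, α v := by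
        rcases hw with hw | hw
        · have := single (Finset.range i) (by intro v hv; simp at hv; omega) w (by simp; omega)
          linarith
        · have := single (Finset.Ico (j + 1 : ℕ) n) (by intro v hv; simp at hv; omega) w
            (by simp; omega)
          linarith
      rcases h1 with ⟨rfl, rfl⟩ | ⟨rfl, rfl⟩
      · rw [disksMeet_comm, add_comm (α i)] at h
        exact not_disksMeet_of_short (hα j j.2) (hα i i.2) h2 g1 (by linarith) h
      · exact not_disksMeet_of_short (hα i i.2) (hα j j.2) h2 g1 (by linarith) h
  refine ⟨n, P, hP, ⟨RelIso.symm ⟨hg.equiv, fun {i j} => ?_⟩⟩⟩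
  change G.Adj (g i) (g j) ↔ i ≠ j ∧ _
  rcases lt_trichotomy i j with h | rfl | h
  · rw [main i j h, and_iff_right h.ne]
  · simp
  · rw [G.adj_comm, main j i h, and_iff_right h.ne', Set.inter_comm]

/-- A cycle of length other than four is realized by a regular polygon. -/
theorem IsCyclicLabelling.sideDiskRealizable_of_no_chord {V : Type*} {G : SimpleGraph V} {n : ℕ}
    {g : ℕ → V} (hg : IsCyclicLabelling G n g) (hn : n ≠ 4)
    (hchord : ∀ i j, i < j → j < n → G.Adj (g i) (g j) → j = i + 1 ∨ i = 0 ∧ j + 1 = n) :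
    SideDiskRealizable G := by
  have hπ := Real.pi_pos
  have h3 : (3 : ℝ) ≤ n := by exact_mod_cast hg.three_le
  have hle : Real.pi / n ≤ Real.pi / 3 := by gcongr
  have hpos : 0 < Real.pi / n := by positivity
  refine hg.sideDiskRealizable (α := fun _ => Real.pi / n) (fun _ _ => hpos) (fun _ _ => hle)
    (by rw [Finset.sum_const, Finset.card_range, nsmul_eq_mul]; field_simp) ?_ ?_
  · intro i j hij hj h
    have hnn : 0 ≤ Real.sin (Real.pi / n) * Real.sin (Real.pi / n) *
        (1 - Real.cos (Real.pi / n + Real.pi / n)) :=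
      mul_nonneg (mul_self_nonneg _) (by linarith [Real.cos_le_one (Real.pi / n + Real.pi / n)])
    rcases hchord i j hij hj h with rfl | ⟨rfl, rfl⟩
    · left; simpa using hnn
    · right; left; simpa using hnn
  · intro i j hij hj h
    have h1 : j ≠ i + 1 := fun h' => h (h' ▸ hg.adj i)
    have h2 : ¬ (i = 0 ∧ j + 1 = n) := by
      rintro ⟨rfl, h'⟩
      refine h (G.adj_comm _ _ |>.1 ?_)
      have := hg.adj j
      rwa [h', ← Nat.zero_add n, hg.periodic] at this
    -- Two non-adjacent sides need `n ≥ 4`, and 4 is excluded.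
    have h5 : (5 : ℝ) ≤ n := by exact_mod_cast (by omega : 5 ≤ n)
    have hle5 : Real.pi / n ≤ Real.pi / 5 := by gcongr
    refine ⟨_, _, Or.inl ⟨rfl, rfl⟩, Or.inl ⟨hle5, hle5, rfl⟩, ⟨i + 1, by omega, by omega, le_rfl⟩,
      ?_⟩
    rcases Nat.eq_zero_or_pos i with h0 | h0
    · exact ⟨j + 1, by omega, by omega, le_rfl⟩
    · exact ⟨0, by omega, by omega, le_rfl⟩

/-- A gap that is small compared to the fourth power of the shorter side is very short. -/
theorem gap_le_of_le_pow_four {α β μ σ : ℝ} (hμ : 0 < μ) (hα : μ ≤ α) (hβ : μ ≤ β)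
    (hα' : α ≤ Real.pi / 3) (hβ' : β ≤ Real.pi / 3) (hσ : σ ≤ μ ^ 4 / 16) :
    2 * σ ≤ Real.sin α * Real.sin β * (1 - Real.cos (α + β)) := by
  have hπ := Real.pi_pos
  have hsμ : μ / 2 ≤ Real.sin μ := by
    have h1 := Real.mul_le_sin hμ.le (by linarith)
    have h2 : (1 / 2 : ℝ) ≤ 2 / Real.pi := by
      rw [div_le_div_iff₀ (by norm_num) hπ]; linarith [Real.pi_le_four]
    nlinarith
  have mono : ∀ x, μ ≤ x → x ≤ Real.pi / 3 → μ / 2 ≤ Real.sin x := fun x h1 h2 =>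
    hsμ.trans (Real.sin_le_sin_of_le_of_le_pi_div_two (by linarith) (by linarith) h1)
  have hc : Real.cos (α + β) ≤ Real.cos (2 * μ) :=
    Real.cos_le_cos_of_nonneg_of_le_pi (by linarith) (by linarith) (by linarith)
  rw [Real.cos_two_mul_eq_one_sub] at hc
  have h1 : μ ^ 2 / 2 ≤ 1 - Real.cos (α + β) := by nlinarith
  have h2 : μ / 2 * (μ / 2) ≤ Real.sin α * Real.sin β :=
    mul_le_mul (mono α hα hα') (mono β hβ hβ') (by linarith) (by linarith [mono α hα hα'])
  -- The product on the left is `μ ^ 4 / 8`, twice the allowed gap.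
  have h3 : μ / 2 * (μ / 2) * (μ ^ 2 / 2) ≤ Real.sin α * Real.sin β * (1 - Real.cos (α + β)) :=
    mul_le_mul h2 h1 (by positivity) (le_trans (by positivity) h2)
  nlinarith

/-! ### Nesting levels of non-crossing chords -/

open Classical in
/-- The number of chords in `E` that pass over the position `v`. -/
noncomputable def chordLevel (E : ℕ → ℕ → Prop) (n v : ℕ) : ℕ :=
  ((Finset.range (n + 1) ×ˢ Finset.range (n + 1)).filter
    fun p => E p.1 p.2 ∧ p.1 < v ∧ v < p.2).card

section Level

variable {E : ℕ → ℕ → Prop} {n : ℕ}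

/-- By non-crossing, a chord over an end of the given chord also passes over everything under it.
The given chord itself makes the inequality strict. -/
theorem chordLevel_lt_of_chord (hE : ∀ i j, E i j → i < j ∧ j ≤ n)
    (hcross : ∀ i j k l, i < j → j < k → k < l → E i k → E j l → False) {i j v w : ℕ}
    (h : E i j) (hv : i < v) (hv' : v < j) (hw : w = i ∨ w = j) :
    chordLevel E n w < chordLevel E n v := by
  classical
  refine Finset.card_lt_card (Finset.ssubset_iff_of_subset ?_ |>.2 ⟨(i, j), ?_, ?_⟩)
  · rintro ⟨a, b⟩ hab
    simp only [Finset.mem_filter, Finset.mem_product, Finset.mem_range] at hab ⊢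
    obtain ⟨h1, h2, h3, h4⟩ := hab
    have hij := hE i j h
    refine ⟨h1, h2, ?_⟩
    rcases hw with rfl | rfl
    · have : ¬ b < j := fun hb => hcross a w b j h3 h4 hb h2 h
      omega
    · have : ¬ i < a := fun hb => hcross i a w b hb h3 h4 h h2
      omega
  · have := hE i j h
    simp only [Finset.mem_filter, Finset.mem_product, Finset.mem_range]
    exact ⟨by omega, h, hv, hv'⟩
  · simp only [Finset.mem_filter, not_and]
    omega

theorem exists_chord_of_chordLevel_lt {v w : ℕ}
    (h : chordLevel E n w < chordLevel E n v) :
    ∃ a b, E a b ∧ a < v ∧ v < b ∧ ¬ (a < w ∧ w < b) := by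
  classical
  by_contra! hcon
  refine absurd (Finset.card_le_card ?_) (not_le.2 h)
  rintro ⟨a, b⟩ hab
  simp only [Finset.mem_filter] at hab ⊢
  exact ⟨hab.1, hab.2.1, hcon a b hab.2.1 hab.2.2.1 hab.2.2.2⟩

/-- If every position in between had higher level, the longest chord from `i` would reach `j` or
beyond, and the longest chord ending at `j` would start at `i` or before. These two chords coincide
with `i j` or cross. -/
theorem exists_chordLevel_le_max (hE : ∀ i j, E i j → i < j ∧ j ≤ n)
    (hcross : ∀ i j k l, i < j → j < k → k < l → E i k → E j l → False) {i j : ℕ}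
    (hij : i + 2 ≤ j) (h : ¬ E i j) :
    ∃ v, i < v ∧ v < j ∧ chordLevel E n v ≤ max (chordLevel E n i) (chordLevel E n j) := by
  classical
  by_contra! hcon
  obtain ⟨b, hb, hjb⟩ : ∃ b, E i b ∧ j ≤ b := by
    by_contra! hno
    obtain ⟨a, b, hab, ha, hb, hn⟩ := exists_chord_of_chordLevel_lt
      ((le_max_left _ _).trans_lt (hcon (i + 1) (by omega) (by omega)))
    obtain rfl : a = i := by omega
    -- Minimizing `n - b` selects the longest chord from this end.
    have hex : ∃ m, ∃ b, E a b ∧ b + m = n := ⟨n - b, b, hab, by have := hE a b hab; omega⟩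
    obtain ⟨c, hc, hcn⟩ := Nat.find_spec hex
    have hcj := hno c hc
    obtain ⟨a', b', hab', ha', hb', hn'⟩ := exists_chord_of_chordLevel_lt
      ((le_max_left _ _).trans_lt (hcon c (hE a c hc).1 hcj))
    rcases (show a ≤ a' by have := (hE a c hc).1; omega).eq_or_lt with rfl | h'
    · refine Nat.find_min hex (m := n - b') ?_ ⟨b', hab', by have := hE _ _ hab'; omega⟩
      have := hE _ _ hab'
      omega
    · exact hcross a a' c b' h' ha' hb' hc hab'
  obtain ⟨a, ha, hai⟩ : ∃ a, E a j ∧ a ≤ i := by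
    by_contra! hno
    obtain ⟨a, b, hab, ha, hb, hn⟩ := exists_chord_of_chordLevel_lt
      ((le_max_right _ _).trans_lt (hcon (j - 1) (by omega) (by omega)))
    obtain rfl : b = j := by omega
    have hex : ∃ a, E a b := ⟨a, hab⟩
    have hc := Nat.find_spec hex
    have hci := hno _ hc
    obtain ⟨a', b', hab', ha', hb', hn'⟩ := exists_chord_of_chordLevel_lt
      ((le_max_right _ _).trans_lt (hcon _ hci (hE _ _ hc).1))
    rcases (show b' ≤ b by have := hE _ _ hc; omega).eq_or_lt with rfl | h'
    · exact Nat.find_min hex ha' hab'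
    · exact hcross a' _ b' b ha' hb' h' hab' hc
  rcases hai.eq_or_lt with rfl | hai
  · exact h ha
  rcases hjb.eq_or_lt with rfl | hjb
  · exact h hb
  exact hcross a i j b hai (by omega) hjb ha hb

end Level

/-- The length assigned to a side at a given nesting level. -/
noncomputable def levelSize (x : ℝ) (n : ℕ) : ℕ → ℝ
  | 0 => x
  | k + 1 => levelSize x n k ^ 4 / (16 * n)

/-! ### Side lengths that shrink rapidly with the nesting level -/

section LevelSize

variable {x : ℝ} {n : ℕ}

theorem levelSize_pos (hx : 0 < x) (hn : 0 < n) (k : ℕ) : 0 < levelSize x n k := by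
  induction k with
  | zero => exact hx
  | succ k ih => rw [levelSize]; positivity

theorem levelSize_succ_le (hx : 0 < x) (hx1 : x ≤ 1) (hn : 0 < n) (k : ℕ) :
    levelSize x n k ≤ 1 ∧ levelSize x n (k + 1) ≤ levelSize x n k := by
  have hn1 : (1 : ℝ) ≤ n := by exact_mod_cast hn
  have aux : ∀ y : ℝ, 0 < y → y ≤ 1 → y ^ 4 / (16 * n) ≤ y := by
    intro y hy hy1
    rw [div_le_iff₀ (by positivity)]
    have := pow_le_of_le_one hy.le hy1 (n := 4) (by norm_num)
    nlinarith
  induction k with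
  | zero => exact ⟨hx1, aux x hx hx1⟩
  | succ k ih =>
    have h1 := ih.2.trans ih.1
    exact ⟨h1, aux _ (levelSize_pos hx hn _) h1⟩

theorem levelSize_antitone (hx : 0 < x) (hx1 : x ≤ 1) (hn : 0 < n) : Antitone (levelSize x n) :=
  antitone_nat_of_succ_le fun k => (levelSize_succ_le hx hx1 hn k).2

/-- Fewer than `n` sides of higher level are very short. -/
theorem sum_le_of_level_lt (hx : 0 < x) (hx1 : x ≤ 1) (hn : 0 < n) {s : Finset ℕ}
    (hs : s.card ≤ n) {f : ℕ → ℕ} {L : ℕ} (hf : ∀ v ∈ s, L < f v) :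
    ∑ v ∈ s, levelSize x n (f v) ≤ levelSize x n L ^ 4 / 16 := by
  have h1 : ∑ v ∈ s, levelSize x n (f v) ≤ s.card • levelSize x n (L + 1) :=
    Finset.sum_le_card_nsmul _ _ _ fun v hv => levelSize_antitone hx hx1 hn (hf v hv)
  have hp := levelSize_pos hx hn L
  have h2 : (s.card : ℝ) ≤ n := by exact_mod_cast hs
  have h3 : (s.card : ℝ) * levelSize x n (L + 1) ≤ n * levelSize x n (L + 1) :=
    mul_le_mul_of_nonneg_right h2 (levelSize_pos hx hn _).le
  rw [nsmul_eq_mul] at h1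
  refine h1.trans (h3.trans (le_of_eq ?_))
  rw [levelSize]
  have : (n : ℝ) ≠ 0 := by positivity
  field_simp

end LevelSize

/-- A Hamiltonian cycle with non-crossing chords, at least one of them, is realizable. -/
theorem IsCyclicLabelling.sideDiskRealizable_of_chord {V : Type*} {G : SimpleGraph V} {n : ℕ}
    {g : ℕ → V} (hg : IsCyclicLabelling G n g)
    (hnc : ∀ i j k l, i < j → j < k → k < l → l < i + n → G.Adj (g i) (g k) →
      G.Adj (g j) (g l) → False) {r : ℕ} (hr : 2 ≤ r) (hrn : r + 2 ≤ n)
    (h0r : G.Adj (g 0) (g r)) : SideDiskRealizable G := by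
  classical
  have hπ := Real.pi_pos
  have hπ3 := Real.pi_gt_three
  have hπ4 := Real.pi_lt_d2
  have hgn : g n = g 0 := by simpa using hg.periodic 0
  -- Position `n` is a second copy of position 0, so every chord lies within `[0, r]` or `[r, n]`.
  -- Both copies of the root chord are left out, so positions just under it can have level 0.
  obtain ⟨E, hEdef⟩ : ∃ E : ℕ → ℕ → Prop, ∀ i j, E i j ↔ i + 2 ≤ j ∧ j ≤ n ∧ G.Adj (g i) (g j) ∧
    (j ≤ r ∨ r ≤ i) ∧ ¬ (i = 0 ∧ j = r) ∧ ¬ (i = r ∧ j = n) := ⟨_, fun _ _ => Iff.rfl⟩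
  have hE : ∀ i j, E i j → i < j ∧ j ≤ n := by
    intro i j h
    have := (hEdef i j).1 h
    omega
  have hcross : ∀ i j k l, i < j → j < k → k < l → E i k → E j l → False := by
    intro i j k l hij hjk hkl h1 h2
    rw [hEdef] at h1 h2
    -- The bound `l < i + n` could fail only for `i = 0` and `l = n`, but then `k ≤ r ≤ j`.
    exact hnc i j k l hij hjk hkl (by omega) h1.2.2.1 h2.2.2.1
  set lam := chordLevel E n with hlam
  have lam0 : ∀ v, v = 0 ∨ v = r ∨ v = n → lam v = 0 := by
    intro v hv
    rw [hlam, chordLevel, Finset.card_eq_zero, Finset.filter_eq_empty_iff]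
    rintro ⟨a, b⟩ - ⟨h, h1, h2⟩
    rw [hEdef] at h
    dsimp only at h1 h2 h
    omega
  have between : ∀ i j, i + 2 ≤ j → ¬ E i j → ∃ v, i < v ∧ v < j ∧ lam v ≤ max (lam i) (lam j) :=
    fun i j hij h => exists_chordLevel_le_max hE hcross hij h
  -- one side of the lowest level on each side of the root chord
  obtain ⟨p, hp0, hpr, hp⟩ := between 0 r hr (by rw [hEdef]; omega)
  obtain ⟨q, hqr, hqn, hq⟩ := between r n hrn (by rw [hEdef]; omega)
  rw [lam0 0 (by simp), lam0 r (by simp), max_self, Nat.le_zero] at hp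
  rw [lam0 r (by simp), lam0 n (by simp), max_self, Nat.le_zero] at hq
  set N := (Finset.range n).filter fun v => ¬ (v = 0 ∨ v = r) with hN
  set Z := N.filter fun v => lam v = 0 with hZ
  have memZ : ∀ v, v ∈ Z ↔ v < n ∧ ¬ (v = 0 ∨ v = r) ∧ lam v = 0 := by
    intro v; simp only [hZ, hN, Finset.mem_filter, Finset.mem_range, and_assoc]
  have hpZ : p ∈ Z := (memZ p).2 ⟨by omega, by omega, hp⟩
  have hqZ : q ∈ Z := (memZ q).2 ⟨by omega, by omega, hq⟩
  have hZ2 : 2 ≤ Z.card := Finset.one_lt_card.2 ⟨p, hpZ, q, hqZ, by omega⟩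
  have hZ3 : ∀ v ∈ Z, ∀ w ∈ Z, v ≠ w → (v < r ↔ w < r) → 3 ≤ Z.card := by
    intro v hv w hw hvw hside
    refine Finset.two_lt_card.2 ?_
    have := (memZ v).1 hv
    have := (memZ w).1 hw
    rcases lt_or_ge v r with h | h
    · exact ⟨v, hv, w, hw, q, hqZ, hvw, by omega, by omega⟩
    · exact ⟨v, hv, w, hw, p, hpZ, hvw, by omega, by omega⟩
  have hZ2' : (2 : ℝ) ≤ Z.card := by exact_mod_cast hZ2
  -- The sides of level 0 other than the root sides share exactly π/3; the higher levels add at most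
  -- 1/80, so the two root sides get nearly π/3 each.
  set x : ℝ := Real.pi / (3 * Z.card) with hx
  have hx0 : 0 < x := by positivity
  have hx6 : x ≤ Real.pi / 6 := by
    rw [hx]; exact div_le_div_of_nonneg_left hπ.le (by norm_num) (by linarith)
  have hx1 : x ≤ 1 := by linarith
  have hn0 : 0 < n := by omega
  have spos := levelSize_pos hx0 hn0
  have santi := levelSize_antitone hx0 hx1 hn0
  have hx4 : x ^ 4 ≤ 1 / 5 := by
    have h1 : x ^ 2 ≤ 0.28 := by nlinarith
    have : x ^ 4 = x ^ 2 * x ^ 2 := by ring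
    nlinarith [sq_nonneg x]
  have s1 : ∀ k, 1 ≤ k → levelSize x n k ≤ 1 / 80 := by
    intro k hk
    have := sum_le_of_level_lt hx0 hx1 hn0 (s := {0}) (f := fun _ => k) (L := 0)
      (by simpa) (by simpa)
    rw [Finset.sum_singleton, levelSize] at this
    linarith
  have hNcard : N.card ≤ n := (Finset.card_filter_le _ _).trans_eq (Finset.card_range n)
  set R := ∑ v ∈ N, levelSize x n (lam v) with hR
  have hRx : Real.pi / 3 ≤ R ∧ R ≤ Real.pi / 3 + 1 / 80 := by
    rw [hR, ← Finset.sum_filter_add_sum_filter_not N (fun v => lam v = 0)]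
    have e1 : ∑ v ∈ N.filter (fun v => lam v = 0), levelSize x n (lam v) = Real.pi / 3 := by
      rw [Finset.sum_congr rfl (g := fun _ => x) fun v hv => by
        rw [(Finset.mem_filter.1 hv).2, levelSize], Finset.sum_const, nsmul_eq_mul, ← hZ, hx]
      field_simp
    have e2 := sum_le_of_level_lt hx0 hx1 hn0 (s := N.filter fun v => ¬ lam v = 0) (f := lam)
      (L := 0) ((Finset.card_filter_le _ _).trans hNcard)
      fun v hv => Nat.pos_of_ne_zero (Finset.mem_filter.1 hv).2
    have e3 : 0 ≤ ∑ v ∈ N.filter (fun v => ¬ lam v = 0), levelSize x n (lam v) :=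
      Finset.sum_nonneg fun v _ => (spos _).le
    rw [levelSize] at e2
    constructor <;> linarith
  set ρ : ℝ := (Real.pi - R) / 2 with hρ
  have hρ3 : ρ ≤ Real.pi / 3 := by linarith
  have hρ4 : Real.pi / 4 ≤ ρ := by linarith
  obtain ⟨α, hαr, hαn⟩ : ∃ α : ℕ → ℝ, (∀ v, v = 0 ∨ v = r → α v = ρ) ∧
      ∀ v, ¬ (v = 0 ∨ v = r) → α v = levelSize x n (lam v) :=
    ⟨fun v => if v = 0 ∨ v = r then ρ else levelSize x n (lam v),
      fun v hv => if_pos hv, fun v hv => if_neg hv⟩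
  have hx' : ∀ k, levelSize x n k ≤ x := fun k => santi (Nat.zero_le k)
  have hαge : ∀ v, levelSize x n (lam v) ≤ α v := by
    intro v
    by_cases hv : v = 0 ∨ v = r
    · rw [hαr v hv]; linarith [hx' (lam v)]
    · exact (hαn v hv).ge
  have hαle : ∀ v, α v ≤ Real.pi / 3 := by
    intro v
    by_cases hv : v = 0 ∨ v = r
    · rw [hαr v hv]; exact hρ3
    · rw [hαn v hv]; linarith [hx' (lam v)]
  have hαsum : ∑ v ∈ Finset.range n, α v = Real.pi := by
    rw [← Finset.sum_filter_add_sum_filter_not _ (fun v => v = 0 ∨ v = r)]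
    have e1 : (Finset.range n).filter (fun v => v = 0 ∨ v = r) = {0, r} := by
      ext v; simp; omega
    rw [e1, Finset.sum_pair (by omega), hαr 0 (by simp), hαr r (by simp),
      Finset.sum_congr rfl (g := fun v => levelSize x n (lam v)) fun v hv =>
        hαn v (Finset.mem_filter.1 hv).2]
    linarith
  -- the arc below a chord is very short
  have under : ∀ i j, E i j → ∀ β γ : ℝ, levelSize x n (lam i) ≤ β → levelSize x n (lam j) ≤ γ →
      β ≤ Real.pi / 3 → γ ≤ Real.pi / 3 → 2 * ∑ v ∈ Finset.Ico (i + 1) j, α v ≤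
        Real.sin β * Real.sin γ * (1 - Real.cos (β + γ)) := by
    intro i j h β γ hβ hγ hβ' hγ'
    have hij := (hEdef i j).1 h
    have hlt : ∀ v ∈ Finset.Ico (i + 1) j, max (lam i) (lam j) < lam v := by
      intro v hv
      rw [Finset.mem_Ico] at hv
      exact max_lt (chordLevel_lt_of_chord hE hcross h hv.1 hv.2 (Or.inl rfl))
        (chordLevel_lt_of_chord hE hcross h hv.1 hv.2 (Or.inr rfl))
    refine gap_le_of_le_pow_four (spos (max (lam i) (lam j)))
      ((santi (le_max_left _ _)).trans hβ) ((santi (le_max_right _ _)).trans hγ) hβ' hγ' ?_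
    rw [Finset.sum_congr rfl (g := fun v => levelSize x n (lam v)) fun v hv => hαn v (by
      rw [Finset.mem_Ico] at hv; omega)]
    exact sum_le_of_level_lt hx0 hx1 hn0 (by rw [Nat.card_Ico]; omega) hlt
  have hK : ∀ β γ : ℝ, 0 ≤ β → β ≤ Real.pi / 3 → 0 ≤ γ → γ ≤ Real.pi / 3 →
      0 ≤ Real.sin β * Real.sin γ * (1 - Real.cos (β + γ)) := fun β γ h1 h2 h3 h4 =>
    mul_nonneg (mul_nonneg (Real.sin_nonneg_of_nonneg_of_le_pi h1 (by linarith))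
      (Real.sin_nonneg_of_nonneg_of_le_pi h3 (by linarith))) (by linarith [Real.cos_le_one (β + γ)])
  have hαpos : ∀ v, 0 < α v := fun v => (spos _).trans_le (hαge v)
  refine hg.sideDiskRealizable (α := α) (fun v _ => hαpos v) (fun v _ => hαle v) hαsum ?_ ?_
  · intro i j hij hj h
    rcases (show i + 1 ≤ j from hij).eq_or_lt with rfl | hij2
    · left
      simpa using hK _ _ (hαpos _).le (hαle _) (hαpos _).le (hαle _)
    by_cases hroot : i = 0 ∧ j = r
    · right; right
      rw [hαr i (Or.inl hroot.1), hαr j (Or.inr hroot.2)]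
      exact ⟨rfl, hρ4⟩
    by_cases hside : j ≤ r ∨ r ≤ i
    · left
      exact under i j ((hEdef i j).2 ⟨hij2, hj.le, h, hside, hroot, by omega⟩) _ _ (hαge i)
        (hαge j) (hαle i) (hαle j)
    · right; left
      -- A chord across the root must start at 0, and is then treated as the chord from `j` to `n`.
      obtain rfl : i = 0 := by
        by_contra hi
        exact hnc 0 i r j (by omega) (by omega) (by omega) (by omega) h0r h
      rw [Finset.range_zero, Finset.sum_empty, zero_add]
      rcases (show j + 1 ≤ n from hj).eq_or_lt with rfl | hjn
      · simpa using hK _ _ (hαpos _).le (hαle _) (hαpos _).le (hαle _)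
      · rw [mul_comm (Real.sin _), add_comm (α 0)]
        refine under j n ((hEdef j n).2 ⟨hjn, le_rfl, ?_, by omega, by omega, by omega⟩) _ _
          (hαge j) ?_ (hαle j) (hαle 0)
        · rw [hgn]; exact h.symm
        · exact (congrArg (levelSize x n) ((lam0 n (by simp)).trans (lam0 0 (by simp)).symm)).trans_le
            (hαge 0)
  · intro i j hij hj h
    have hj1 : j ≠ i + 1 := fun h' => h (h' ▸ hg.adj i)
    have hroot : ¬ (i = 0 ∧ j = r) := by rintro ⟨rfl, rfl⟩; exact h h0r
    have hin : ∃ v, i < v ∧ v < j ∧ levelSize x n (max (lam i) (lam j)) ≤ α v := by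
      by_cases hside : j ≤ r ∨ r ≤ i
      · obtain ⟨v, h1, h2, h3⟩ := between i j (by omega)
          (fun h' => h ((hEdef i j).1 h').2.2.1)
        exact ⟨v, h1, h2, (santi h3).trans (hαge v)⟩
      -- The root side at `r` lies in between and is longer than any non-root side.
      · refine ⟨r, by omega, by omega, ?_⟩
        rw [hαr r (by simp)]
        linarith [hx' (max (lam i) (lam j))]
    have hout_root : ∀ v, v = 0 ∨ v = r → levelSize x n (max (lam i) (lam j)) ≤ α v := by
      intro v hv
      rw [hαr v hv]
      linarith [hx' (max (lam i) (lam j))]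
    have hj0 : i = 0 → ¬ j + 1 = n ∧ ¬ E j n := by
      rintro rfl
      refine ⟨fun h' => h ?_, fun h' => h ?_⟩
      · have := hg.adj j
        rw [h', hgn] at this
        exact this.symm
      · have := ((hEdef j n).1 h').2.2.1
        rw [hgn] at this
        exact this.symm
    have hout : ∃ v < n, (v < i ∨ j < v) ∧ levelSize x n (max (lam i) (lam j)) ≤ α v := by
      rcases Nat.eq_zero_or_pos i with h0 | h0
      · rcases lt_trichotomy j r with h' | h' | h'
        · exact ⟨r, by omega, by omega, hout_root r (by simp)⟩
        · exact absurd ⟨h0, h'⟩ hroot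
        · obtain ⟨v, h1, h2, h3⟩ := between j n (by have := hj0 h0; omega) (hj0 h0).2
          refine ⟨v, h2, Or.inr h1, (santi ?_).trans (hαge v)⟩
          rw [h0, lam0 0 (by simp), ← lam0 n (by simp), max_comm]
          exact h3
      · exact ⟨0, hn0, Or.inl h0, hout_root 0 (by simp)⟩
    -- with a root side, level zero forces at least three sides of level zero
    have h9 : (i = 0 ∨ i = r ∨ j = 0 ∨ j = r) → max (lam i) (lam j) = 0 → 3 ≤ Z.card := by
      intro hir hmax
      have hli : lam i = 0 := by omega
      have hlj : lam j = 0 := by omega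
      have mid : ∀ a b, a + 2 ≤ b → ¬ E a b → lam a = 0 → lam b = 0 → ∃ v, a < v ∧ v < b ∧
          lam v = 0 := by
        intro a b hab hEab ha hb
        obtain ⟨v, h1, h2, h3⟩ := between a b hab hEab
        exact ⟨v, h1, h2, by omega⟩
      have hEij : ¬ E i j := fun h' => h ((hEdef i j).1 h').2.2.1
      by_cases hside : j ≤ r ∨ r ≤ i
      · obtain ⟨v, h1, h2, h3⟩ := mid i j (by omega) hEij hli hlj
        have hvZ : v ∈ Z := (memZ v).2 ⟨by omega, by omega, h3⟩
        by_cases hi : i = 0 ∨ i = r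
        · exact hZ3 v hvZ j ((memZ j).2 ⟨hj, by omega, hlj⟩) (by omega) (by omega)
        · exact hZ3 v hvZ i ((memZ i).2 ⟨by omega, hi, hli⟩) (by omega) (by omega)
      · have hi0 : i = 0 := by omega
        obtain ⟨v, h1, h2, h3⟩ := mid j n (by have := hj0 hi0; omega) (hj0 hi0).2 hlj
          (lam0 n (by simp))
        exact hZ3 v ((memZ v).2 ⟨by omega, by omega, h3⟩) j ((memZ j).2 ⟨hj, by omega, hlj⟩)
          (by omega) (by omega)
    have hle6 : ∀ v, ¬ (v = 0 ∨ v = r) → α v ≤ Real.pi / 6 := fun v hv => by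
      rw [hαn v hv]; linarith [hx' (lam v)]
    have hle9 : (i = 0 ∨ i = r ∨ j = 0 ∨ j = r) →
        levelSize x n (max (lam i) (lam j)) ≤ Real.pi / 9 := by
      intro hir
      rcases Nat.eq_zero_or_pos (max (lam i) (lam j)) with h0 | h0
      · have : (3 : ℝ) ≤ Z.card := by exact_mod_cast h9 hir h0
        rw [h0, levelSize, hx]
        exact div_le_div_of_nonneg_left hπ.le (by norm_num) (by linarith)
      · linarith [s1 _ h0]
    have short : ∀ a b, a = i ∧ b = j ∨ a = j ∧ b = i → ¬ (a = 0 ∨ a = r) →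
        lam a = max (lam i) (lam j) → (α b ≤ Real.pi / 6 ∧ α a ≤ Real.pi / 6 ∨
          α b ≤ Real.pi / 3 ∧ α a ≤ Real.pi / 9) ∧ α a = levelSize x n (max (lam i) (lam j)) := by
      intro a b hab ha hla
      have hαa : α a = levelSize x n (max (lam i) (lam j)) := by rw [hαn a ha, hla]
      refine ⟨?_, hαa⟩
      by_cases hb : b = 0 ∨ b = r
      · right
        rw [hαa]
        exact ⟨hαle b, hle9 (by omega)⟩
      · exact Or.inl ⟨hle6 b hb, hle6 a ha⟩
    -- The end of higher level is taken as the short side; root sides have level 0 and at most one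
    -- end is a root side, so it can be chosen outside the root.
    rcases (show (¬ (i = 0 ∨ i = r) ∧ lam i = max (lam i) (lam j)) ∨
        (¬ (j = 0 ∨ j = r) ∧ lam j = max (lam i) (lam j)) by
      by_cases hi : i = 0 ∨ i = r
      · have := lam0 i (by omega)
        right; omega
      · by_cases hj' : j = 0 ∨ j = r
        · have := lam0 j (by omega)
          left; omega
        · omega) with ⟨h1, h2⟩ | ⟨h1, h2⟩
    · obtain ⟨h3, h4⟩ := short i j (Or.inl ⟨rfl, rfl⟩) h1 h2
      rw [← h4] at hin hout
      exact ⟨α i, α j, Or.inl ⟨rfl, rfl⟩, Or.inr h3, hin, hout⟩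
    · obtain ⟨h3, h4⟩ := short j i (Or.inr ⟨rfl, rfl⟩) h1 h2
      rw [← h4] at hin hout
      exact ⟨α j, α i, Or.inr ⟨rfl, rfl⟩, Or.inr h3, hin, hout⟩

/-- A Hamiltonian cycle gives a cyclic labelling. -/
theorem SimpleGraph.Walk.IsHamiltonianCycle.exists_isCyclicLabelling {V : Type*} [DecidableEq V]
    {G : SimpleGraph V} {a : V} {p : G.Walk a a} (hp : p.IsHamiltonianCycle) :
    ∃ g : ℕ → V, IsCyclicLabelling G p.length g := by
  have h3 := hp.isCycle.three_le_length
  have hmod : ∀ k, k % p.length < p.length := fun k => Nat.mod_lt _ (by omega)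
  refine ⟨fun k => p.getVert (k % p.length), h3, fun k => by simp, ?_, ?_, ?_⟩
  · intro i j hij hji h
    have h1 : i % p.length = j % p.length := hp.isCycle.getVert_injOn'
      (by simp only [Set.mem_ofPred_eq]; have := hmod i; omega)
      (by simp only [Set.mem_ofPred_eq]; have := hmod j; omega) h
    have h2 := (Nat.modEq_iff_dvd' hij.le).1 h1
    have := Nat.le_of_dvd (by omega) h2
    omega
  · intro v
    obtain ⟨i, hi, hil⟩ := SimpleGraph.Walk.mem_support_iff_exists_getVert.1 (hp.mem_support v)
    rcases hil.lt_or_eq with h | h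
    · exact ⟨i, h, by simp only [Nat.mod_eq_of_lt h, hi]⟩
    · refine ⟨0, by omega, ?_⟩
      rw [h, SimpleGraph.Walk.getVert_length] at hi
      simpa using hi
  · intro k
    have h1 := p.adj_getVert_succ (hmod k)
    have h2 : p.getVert ((k + 1) % p.length) = p.getVert (k % p.length + 1) := by
      rcases (show k % p.length + 1 ≤ p.length from hmod k).lt_or_eq with h | h
      · rw [← Nat.mod_add_mod, Nat.mod_eq_of_lt h]
      · rw [← Nat.mod_add_mod, h]
        simp
    rwa [← h2] at h1

theorem mainTheorem3 {V : Type*} [Fintype V] [DecidableEq V] (G : SimpleGraph V)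
    (houter : IsOuterplanar G)
    (hham : ∃ (a : V) (p : G.Walk a a), p.IsHamiltonianCycle)
    (hC4 : ¬ Nonempty (G ≃g SimpleGraph.cycleGraph 4)) :
    SideDiskRealizable G := by
  obtain ⟨a, p, hp⟩ := hham
  obtain ⟨g, hg⟩ := hp.exists_isCyclicLabelling
  generalize p.length = n at hg
  by_cases hchord : ∃ i j, i < j ∧ j < n ∧ G.Adj (g i) (g j) ∧ ¬ (j = i + 1 ∨ i = 0 ∧ j + 1 = n)
  · obtain ⟨i, j, hij, hj, hadj, hne⟩ := hchord
    -- The labelling is rotated so that the chord found starts at position 0 and serves as root.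
    refine (hg.shift i).sideDiskRealizable_of_chord (r := j - i) ?_ (by omega) (by omega) ?_
    · intro a b c d hab hbc hcd hda h1 h2
      exact houter.not_crossing hg (by omega) (by omega) (by omega) (by omega) h1 h2
    · simpa [Nat.sub_add_cancel hij.le] using hadj
  · have hno : ∀ i j, i < j → j < n → G.Adj (g i) (g j) → j = i + 1 ∨ i = 0 ∧ j + 1 = n := by
      intro i j h1 h2 h3
      by_contra h4
      exact hchord ⟨i, j, h1, h2, h3, h4⟩
    refine hg.sideDiskRealizable_of_no_chord ?_ hno
    rintro rfl
    refine hC4 ⟨RelIso.symm ⟨hg.equiv, fun {i j} => ?_⟩⟩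
    change G.Adj (g i) (g j) ↔ _
    have a01 := hg.adj 0
    have a12 := hg.adj 1
    have a23 := hg.adj 2
    have a30 : G.Adj (g 3) (g 0) := by simpa [hg.periodic 0] using hg.adj 3
    have n02 : ¬ G.Adj (g 0) (g 2) := fun h => by have := hno 0 2 (by omega) (by omega) h; omega
    have n13 : ¬ G.Adj (g 1) (g 3) := fun h => by have := hno 1 3 (by omega) (by omega) h; omega
    have n20 : ¬ G.Adj (g 2) (g 0) := fun h => n02 h.symm
    have n31 : ¬ G.Adj (g 3) (g 1) := fun h => n13 h.symm
    rw [SimpleGraph.cycleGraph_adj]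
    fin_cases i <;> fin_cases j <;>
      simp [a01, a12, a23, a30, n02, n13, a01.symm, a12.symm, a23.symm, a30.symm,
        n20, n31] <;>
      decide
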